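/- Let $(I,\mathcal A,\mu)$ be a probability space with a good grid: a sequence $(\mathcal P^k)_{k\ge 0}$ of finite measurable partitions of $I$ (up to null sets) with $\mathcal P^0=\{I\}$, such that every $Q\in\mathcal P^{k+1}$ is contained in some $P\in\mathcal P^k$ ($Q$ is then a child of $P$), such that for some $\lambda_*,\lambda\in(0,1)$ all children $Q$ of all cells $P$ satisfy $\lambda_*\le |Q|/|P|\le\lambda$, where $|A|=\mu(A)$, and such that $\mathcal A$ is generated by $\bigcup_k\mathcal P^k$. For every cell $Q$ fix a total order of its children, and let $\mathcal H_Q$ be the set of pairs $(S_1,S_2)$ obtained by repeatedly splitting the ordered family of children: a block of $n\ge2$ consecutive children is split into its first $\lfloor n/2\rfloor$ and its last $n-\lfloor n/2\rfloor$ members. The unbalanced Haar wavelet of the pair is $$\phi_{(S_1,S_2)}=\frac{\sum_{P\in S_1}1_P}{\sum_{P\in S_1}|P|}-\frac{\sum_{R\in S_2}1_R}{\sum_{R\in S_2}|R|}.$$ Let $s>0$. The space $B^s_{\infty,\infty}$ consists of the $\psi\in L^\infty(\mu)$ of the form $\psi=c_I1_I+\sum_k\sum_{Q\in\mathcal P^k}\sum_{S\in\mathcal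 H_Q}|Q|^{1+s}c_S\phi_S$ (convergence in $L^\infty$, complex coefficients) with $|\psi|_{B^s_{\infty,\infty}}=|c_I|+\sup_S|c_S|<\infty$. The space $B^{-s}_{1,1}$ consists of the continuous linear functionals $\varphi$ on $B^s_{\infty,\infty}$ of the form $$\varphi(\psi)=d_I\int\psi\,d\mu+\sum_{k}\sum_{Q\in\mathcal P^k}\sum_{S\in\mathcal H_Q}d_S|Q|^{-s}\int\psi\,\phi_S\,d\mu,\qquad |\varphi|_{B^{-s}_{1,1}}:=|d_I|+\sum_S|d_S|<\infty .$$ Let $\hat I$ be the set of sequences $x=(Q_0,Q_1,\dots)$ with $Q_0=I$ and $Q_{j+1}$ a child of $Q_j$. The Dirac mass at $x$ is $\delta_x=\lim_j 1_{Q_j}/|Q_j|$, the limit being taken in the norm of $B^{-s}_{1,1}$ (bounded functions act by integration). For $x\ne y$ in $\hat I$ let $\hat d(x,y)=|P|$, where $P$ is the last common cell of $x$ and $y$, and let $\hat d(x,x)=0$. Theorem. For $\varphi\in B^{-s}_{1,1}$ consider all representations $$\varphi=\sum_{i=0}^\infty c_i\delta_{z_i}+\sum_{j=0}^\infty b_j(\delta_{y_j}-\delta_{x_j}),\qquad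 c_i,b_j\in\mathbb C,\ x_j,y_j,z_i\in\hat I,$$ in which both series converge in $B^{-s}_{1,1}$. Let $|\varphi|_{DD^s}$ be the infimum over these representations of $\sum_i|c_i|+\sum_j|b_j|\,\hat d(x_j,y_j)^s$, and let $|\varphi|_{DD}$ be the infimum of $\sum_i|c_i|+\sum_j|b_j|\,|\delta_{y_j}-\delta_{x_j}|_{B^{-s}_{1,1}}$. Then $|\cdot|_{DD^s}$ and $|\cdot|_{DD}$ are (finite) norms on $B^{-s}_{1,1}$, and both are equivalent to $|\cdot|_{B^{-s}_{1,1}}$: there is $C>0$ such that $C^{-1}|\varphi|_{B^{-s}_{1,1}}\le|\varphi|_{DD^s}\le C|\varphi|_{B^{-s}_{1,1}}$ for all $\varphi\in B^{-s}_{1,1}$, and likewise for $|\cdot|_{DD}$. -/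

import Mathlib

open MeasureTheory Filter Topology
open scoped ENNReal

noncomputable section

namespace DiracDipole

/-- A good grid on the measure space `(Ω, μ)`: a nested sequence of finite measurable partitions
(up to null sets), starting with `{Ω}`, such that the measures of a cell and of its father are
comparable, and generating the σ-algebra. -/
structure GoodGrid {Ω : Type*} [mΩ : MeasurableSpace Ω] (μ : Measure Ω) where
  /-- the cells of level `k` -/
  part : ℕ → Finset (Set Ω)
  measurableSet_of_mem : ∀ k, ∀ Q ∈ part k, MeasurableSet Q
  aedisjoint : ∀ k, (part k : Set (Set Ω)).Pairwise (AEDisjoint μ)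
  ae_cover : ∀ k, ∀ᵐ x ∂μ, ∃ Q ∈ part k, x ∈ Q
  part_zero : part 0 = {Set.univ}
  nested : ∀ k, ∀ Q ∈ part (k + 1), ∃ P ∈ part k, Q ⊆ P
  ratio : ∃ lamStar lam : ℝ, 0 < lamStar ∧ lamStar < 1 ∧ 0 < lam ∧ lam < 1 ∧
    ∀ k, ∀ P ∈ part k, ∀ Q ∈ part (k + 1), Q ⊆ P →
      lamStar ≤ μ.real Q / μ.real P ∧ μ.real Q / μ.real P ≤ lam
  generates : mΩ = MeasurableSpace.generateFrom (⋃ k, (part k : Set (Set Ω)))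

/-- The pairs obtained from a finite ordered family `l` by repeated halving: a block with
`n ≥ 2` elements is split into its first `⌊n/2⌋` elements and the remaining ones; this pair is
recorded and both halves are treated in the same way. -/
def haarPairs {α : Type*} (l : List α) : Set (List α × List α) :=
  if 2 ≤ l.length then
    insert (l.take (l.length / 2), l.drop (l.length / 2))
      (haarPairs (l.take (l.length / 2)) ∪ haarPairs (l.drop (l.length / 2)))
  else ∅
termination_by l.length
decreasing_by
  · simp only [List.length_take]; omega
  · simp only [List.length_drop]; omega

theorem haarPairs_finite {α : Type*} (l : List α) : (haarPairs l).Finite := by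
  induction h : l.length using Nat.strong_induction_on generalizing l with
  | _ n ih =>
    rw [haarPairs]
    split_ifs with h2
    · refine ((ih _ ?_ (l.take (l.length / 2)) rfl).union
        (ih _ ?_ (l.drop (l.length / 2)) rfl)).insert _
      · simp only [List.length_take]; omega
      · simp only [List.length_drop]; omega
    · exact Set.finite_empty

instance {α : Type*} (l : List α) : Fintype (haarPairs l) := (haarPairs_finite l).fintype

variable {Ω : Type*} [MeasurableSpace Ω] {μ : Measure Ω}

/-- The cells of level `k`. -/
abbrev GoodGrid.Cell (G : GoodGrid μ) (k : ℕ) : Type _ := {Q : Set Ω // Q ∈ G.part k}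

/-- The unbalanced Haar systems of a good grid depend on the choice of a total order on the set
of children of every cell, that is, of an enumeration of the children. -/
structure HaarSystem (G : GoodGrid μ) where
  /-- the children of the cell `Q` of level `k`, in increasing order -/
  order : (k : ℕ) → G.Cell k → List (G.Cell (k + 1))
  nodup : ∀ k Q, (order k Q).Nodup
  mem_order : ∀ k Q R, R ∈ order k Q ↔ R.1 ⊆ Q.1

section Spaces

variable [IsProbabilityMeasure μ] {G : GoodGrid μ}

/-- The characteristic function of a cell. -/
def cellFun (G : GoodGrid μ) {k : ℕ} (Q : G.Cell k) : Lp ℂ ∞ μ :=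
  indicatorConstLp ∞ (G.measurableSet_of_mem k Q.1 Q.2) (measure_ne_top μ Q.1) 1

/-- The constant function `1`. -/
def oneFun (μ : Measure Ω) [IsProbabilityMeasure μ] : Lp ℂ ∞ μ :=
  indicatorConstLp ∞ MeasurableSet.univ (measure_ne_top μ Set.univ) 1

/-- The normalised characteristic function
`(∑ P ∈ S, 1_P) / (∑ P ∈ S, |P|)` of a family of cells. -/
def blockFun (G : GoodGrid μ) {k : ℕ} (S : List (G.Cell k)) : Lp ℂ ∞ μ :=
  (((S.map fun P => μ.real P.1).sum : ℝ) : ℂ)⁻¹ • (S.map fun P => cellFun G P).sum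

/-- The unbalanced Haar wavelet of a pair `(S₁, S₂)` of families of cells. -/
def haar (G : GoodGrid μ) {k : ℕ} (S : List (G.Cell k) × List (G.Cell k)) : Lp ℂ ∞ μ :=
  blockFun G S.1 - blockFun G S.2

/-- The triples `(k, Q, S)` with `Q` a cell of level `k` and `S ∈ 𝓗_Q`. -/
abbrev HaarSystem.Idx (H : HaarSystem G) : Type _ :=
  (k : ℕ) × (Q : G.Cell k) × haarPairs (H.order k Q)

/-- `ψ = c_I 1 + ∑_k ∑_{Q ∈ 𝓟^k} ∑_{S ∈ 𝓗_Q} |Q|^{1+s} c_S φ_S`, in `L^∞`. -/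
def HaarSystem.IsFunSeries (H : HaarSystem G) (s : ℝ) (ψ : Lp ℂ ∞ μ) (cI : ℂ)
    (c : H.Idx → ℂ) : Prop :=
  Tendsto (fun N : ℕ => cI • oneFun μ +
      ∑ k ∈ Finset.range N, ∑ Q : G.Cell k, ∑ S : haarPairs (H.order k Q),
        (((μ.real Q.1 ^ (1 + s) : ℝ) : ℂ) * c ⟨k, Q, S⟩) • haar G S.1)
    atTop (𝓝 ψ)

/-- The Besov space `B^s_{∞,∞}`. -/
def HaarSystem.besov (H : HaarSystem G) (s : ℝ) : Submodule ℂ (Lp ℂ ∞ μ) where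
  carrier := {ψ | ∃ (cI : ℂ) (c : H.Idx → ℂ), H.IsFunSeries s ψ cI c ∧ ∃ M : ℝ, ∀ i, ‖c i‖ ≤ M}
  zero_mem' := by
    refine ⟨0, fun _ => 0, ?_, 0, by simp⟩
    simp only [HaarSystem.IsFunSeries, mul_zero, zero_smul, Finset.sum_const_zero, add_zero]
    exact tendsto_const_nhds
  add_mem' := by
    rintro ψ ψ' ⟨cI, c, h, M, hM⟩ ⟨cI', c', h', M', hM'⟩
    refine ⟨cI + cI', fun i => c i + c' i, ?_, M + M', fun i =>
      (norm_add_le _ _).trans (add_le_add (hM i) (hM' i))⟩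
    refine (Tendsto.add h h').congr fun N => ?_
    simp only [mul_add, add_smul, Finset.sum_add_distrib]
    abel
  smul_mem' := by
    rintro a ψ ⟨cI, c, h, M, hM⟩
    refine ⟨a * cI, fun i => a * c i, ?_, ‖a‖ * M, fun i => ?_⟩
    · refine (Tendsto.const_smul h a).congr fun N => ?_
      rw [smul_add, smul_smul, Finset.smul_sum]
      refine congrArg _ (Finset.sum_congr rfl fun k _ => ?_)
      rw [Finset.smul_sum]
      refine Finset.sum_congr rfl fun Q _ => ?_
      rw [Finset.smul_sum]
      refine Finset.sum_congr rfl fun S _ => ?_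
      rw [smul_smul, mul_left_comm]
    · rw [norm_mul]
      exact mul_le_mul_of_nonneg_left (hM i) (norm_nonneg a)

/-- The norm `|c_I| + sup |c_S|` of `B^s_{∞,∞}` (the coefficients are unique, so that the infimum
is over one representation). -/
def HaarSystem.besovNorm (H : HaarSystem G) (s : ℝ) (ψ : Lp ℂ ∞ μ) : ℝ≥0∞ :=
  ⨅ (cI : ℂ) (c : H.Idx → ℂ) (_ : H.IsFunSeries s ψ cI c), ‖cI‖ₑ + ⨆ i, ‖c i‖ₑ

/-- The linear functionals on `B^s_{∞,∞}`. -/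
abbrev HaarSystem.Functional (H : HaarSystem G) (s : ℝ) : Type _ := H.besov s →ₗ[ℂ] ℂ

theorem integrable_mul (g ψ : Lp ℂ ∞ μ) : Integrable (fun x => ψ x * g x) μ :=
  ((Lp.memLp g).mul (r := ∞) (Lp.memLp ψ)).integrable le_top

/-- A bounded function `g`, seen as the functional `ψ ↦ ∫ ψ g dμ`. -/
def HaarSystem.ofFun (H : HaarSystem G) (s : ℝ) (g : Lp ℂ ∞ μ) : H.Functional s where
  toFun ψ := ∫ x, (ψ : Lp ℂ ∞ μ) x * g x ∂μ
  map_add' ψ ψ' := by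
    rw [← integral_add (integrable_mul g _) (integrable_mul g _)]
    refine integral_congr_ae ?_
    filter_upwards [Lp.coeFn_add (ψ : Lp ℂ ∞ μ) (ψ' : Lp ℂ ∞ μ)] with x hx
    rw [Submodule.coe_add, hx, Pi.add_apply, add_mul]
  map_smul' a ψ := by
    rw [RingHom.id_apply, smul_eq_mul, ← integral_const_mul]
    refine integral_congr_ae ?_
    filter_upwards [Lp.coeFn_smul a (ψ : Lp ℂ ∞ μ)] with x hx
    rw [Submodule.coe_smul, hx, Pi.smul_apply, smul_eq_mul, mul_assoc]

/-- `φ(ψ) = d_I ∫ ψ dμ + ∑_k ∑_{Q ∈ 𝓟^k} ∑_{S ∈ 𝓗_Q} d_S |Q|^{-s} ∫ ψ φ_S dμ` for all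
`ψ` in `B^s_{∞,∞}`. -/
def HaarSystem.IsDistSeries (H : HaarSystem G) (s : ℝ) (φ : H.Functional s) (dI : ℂ)
    (d : H.Idx → ℂ) : Prop :=
  ∀ ψ : H.besov s, Tendsto (fun N : ℕ => dI * H.ofFun s (oneFun μ) ψ +
      ∑ k ∈ Finset.range N, ∑ Q : G.Cell k, ∑ S : haarPairs (H.order k Q),
        d ⟨k, Q, S⟩ * ((μ.real Q.1 ^ (-s) : ℝ) : ℂ) * H.ofFun s (haar G S.1) ψ)
    atTop (𝓝 (φ ψ))

/-- The Besov space of distributions `B^{-s}_{1,1}`: the continuous functionals on `B^s_{∞,∞}`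
that have a representation with an absolutely summable family of coefficients. -/
def HaarSystem.negBesov (H : HaarSystem G) (s : ℝ) : Submodule ℂ (H.Functional s) where
  carrier := {φ |
    (∃ C : ℝ, ∀ ψ : H.besov s, ‖φ ψ‖ₑ ≤ ENNReal.ofReal C * H.besovNorm s ψ) ∧
    ∃ (dI : ℂ) (d : H.Idx → ℂ), H.IsDistSeries s φ dI d ∧ Summable fun i => ‖d i‖}
  zero_mem' := by
    refine ⟨⟨0, by simp⟩, 0, fun _ => 0, fun ψ => ?_, by simp⟩
    simp only [zero_mul, Finset.sum_const_zero, add_zero, LinearMap.zero_apply]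
    exact tendsto_const_nhds
  add_mem' := by
    rintro φ φ' ⟨⟨C, hC⟩, dI, d, h, hd⟩ ⟨⟨C', hC'⟩, dI', d', h', hd'⟩
    refine ⟨⟨max C 0 + max C' 0, fun ψ => ?_⟩, dI + dI', fun i => d i + d' i, fun ψ => ?_,
      Summable.of_nonneg_of_le (fun _ => norm_nonneg _) (fun i => norm_add_le _ _) (hd.add hd')⟩
    · rw [ENNReal.ofReal_add (le_max_right _ _) (le_max_right _ _), add_mul, LinearMap.add_apply]
      refine (enorm_add_le _ _).trans (add_le_add ((hC ψ).trans ?_) ((hC' ψ).trans ?_)) <;>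
      · gcongr
        exact le_max_left _ _
    · rw [LinearMap.add_apply]
      refine ((h ψ).add (h' ψ)).congr fun N => ?_
      simp only [add_mul, Finset.sum_add_distrib]
      abel
  smul_mem' := by
    rintro a φ ⟨⟨C, hC⟩, dI, d, h, hd⟩
    refine ⟨⟨‖a‖ * C, fun ψ => ?_⟩, a * dI, fun i => a * d i, fun ψ => ?_, ?_⟩
    · rw [ENNReal.ofReal_mul (norm_nonneg a), ofReal_norm, mul_assoc, LinearMap.smul_apply,
        smul_eq_mul, enorm_mul]
      gcongr
      exact hC ψ
    · rw [LinearMap.smul_apply, smul_eq_mul]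
      refine ((h ψ).const_mul a).congr fun N => ?_
      simp only [mul_add, Finset.mul_sum, mul_assoc]
    · simpa only [norm_mul] using hd.mul_left ‖a‖

/-- The norm `|d_I| + ∑ |d_S|` of `B^{-s}_{1,1}` (the coefficients are unique, so that the infimum
is over one representation); it is `∞` off `B^{-s}_{1,1}`. -/
def HaarSystem.negNorm (H : HaarSystem G) (s : ℝ) (φ : H.Functional s) : ℝ≥0∞ :=
  ⨅ (dI : ℂ) (d : H.Idx → ℂ) (_ : H.IsDistSeries s φ dI d), ‖dI‖ₑ + ∑' i, ‖d i‖ₑ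

/-- `φₙ → φ` in the norm of `B^{-s}_{1,1}`. -/
def HaarSystem.NegTendsto (H : HaarSystem G) (s : ℝ) (u : ℕ → H.Functional s)
    (φ : H.Functional s) : Prop :=
  φ ∈ H.negBesov s ∧ Tendsto (fun n => H.negNorm s (u n - φ)) atTop (𝓝 0)

/-- The set `Î` of all sequences `(Q₀, Q₁, …)` with `Q₀ = Ω` (the only cell of level `0`) and
`Q_{j+1}` a child of `Q_j`. -/
structure Point (G : GoodGrid μ) where
  cell : (n : ℕ) → G.Cell n
  subset : ∀ n, (cell (n + 1)).1 ⊆ (cell n).1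

open Classical in
/-- The metric on `Î`: the measure of the last common cell of `x` and `y` if `x ≠ y`, and `0`
otherwise. -/
def dHat (x y : Point G) : ℝ :=
  if h : ∃ n, x.cell (n + 1) ≠ y.cell (n + 1) then μ.real (x.cell (Nat.find h)).1 else 0

open Classical in
/-- The Dirac mass at `x = (Q₀, Q₁, …)`: the limit of `1_{Q_j} / |Q_j|` in the norm of
`B^{-s}_{1,1}`. -/
def HaarSystem.dirac (H : HaarSystem G) (s : ℝ) (x : Point G) : H.Functional s :=
  if h : ∃ φ, H.NegTendsto s (fun j => H.ofFun s
      (((μ.real (x.cell j).1 : ℝ) : ℂ)⁻¹ • cellFun G (x.cell j))) φ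
  then h.choose else 0

/-- `φ = ∑ c_i δ_{z_i} + ∑ b_j (δ_{y_j} - δ_{x_j})`, where both series converge in
`B^{-s}_{1,1}`. -/
def HaarSystem.IsDiracDipoleRep (H : HaarSystem G) (s : ℝ) (φ : H.Functional s)
    (c : ℕ → ℂ) (z : ℕ → Point G) (b : ℕ → ℂ) (x y : ℕ → Point G) : Prop :=
  ∃ φ₁ φ₂ : H.Functional s, φ = φ₁ + φ₂ ∧
    H.NegTendsto s (fun N => ∑ i ∈ Finset.range N, c i • H.dirac s (z i)) φ₁ ∧
    H.NegTendsto s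
      (fun N => ∑ j ∈ Finset.range N, b j • (H.dirac s (y j) - H.dirac s (x j))) φ₂

/-- The infimum of the costs `∑ |c_i| + ∑ |b_j| w(x_j, y_j)` over all Dirac-dipole
representations of `φ` (those of infinite cost do not matter), for a weight `w` on pairs of
points. -/
def HaarSystem.ddNormWith (H : HaarSystem G) (s : ℝ) (w : Point G → Point G → ℝ≥0∞)
    (φ : H.Functional s) : ℝ≥0∞ :=
  ⨅ (c : ℕ → ℂ) (z : ℕ → Point G) (b : ℕ → ℂ) (x : ℕ → Point G) (y : ℕ → Point G)
    (_ : H.IsDiracDipoleRep s φ c z b x y),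
    ∑' i, ‖c i‖ₑ + ∑' j, ‖b j‖ₑ * w (x j) (y j)

/-- The Dirac-dipole norm with dipoles weighted by `d̂(x, y)^s`. -/
def HaarSystem.ddNorm (H : HaarSystem G) (s : ℝ) (φ : H.Functional s) : ℝ≥0∞ :=
  H.ddNormWith s (fun x y => ENNReal.ofReal (dHat x y ^ s)) φ

/-- The Dirac-dipole norm with dipoles weighted by their norm in `B^{-s}_{1,1}`. -/
def HaarSystem.ddNorm' (H : HaarSystem G) (s : ℝ) (φ : H.Functional s) : ℝ≥0∞ :=
  H.ddNormWith s (fun x y => H.negNorm s (H.dirac s y - H.dirac s x)) φ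

end Spaces

/-- `n` is a (finite) norm on the subspace `V`. -/
def IsNormOn {E : Type*} [AddCommGroup E] [Module ℂ E] (V : Submodule ℂ E)
    (n : E → ℝ≥0∞) : Prop :=
  (∀ φ ∈ V, n φ < ∞) ∧ (∀ φ ∈ V, n φ = 0 ↔ φ = 0) ∧
    (∀ (a : ℂ), ∀ φ ∈ V, n (a • φ) = ‖a‖ₑ * n φ) ∧
    ∀ φ ∈ V, ∀ φ' ∈ V, n (φ + φ') ≤ n φ + n φ'

/-- `n` and `n'` are equivalent on the subspace `V`. -/
def EquivOn {E : Type*} [AddCommGroup E] [Module ℂ E] (V : Submodule ℂ E)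
    (n n' : E → ℝ≥0∞) : Prop :=
  ∃ C : ℝ, 0 < C ∧ ∀ φ ∈ V, n φ ≤ ENNReal.ofReal C * n' φ ∧ n' φ ≤ ENNReal.ofReal C * n φ

end DiracDipole

end

/-! Wavelets with different indices are orthogonal for the bilinear pairing `∫ f g dμ`, and all of
them are orthogonal to `1`. Testing a distribution on `1` and on the wavelets therefore recovers its
coefficients, so `synth` identifies `B^{-s}_{1,1}` with an `ℓ¹` space, isometrically
(`mem_negBesov_iff`, `negNorm_synth`, `negTendsto_synth_iff`). The theorem becomes a statement about
the vectors `diracCoeff` in `ℓ¹`.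

Lower bound. If `R` is a child of `Q`, then `1_R/|R| - 1_Q/|Q|` is a combination of wavelets of `Q`,
one per halving on the way to `R`, whose normalised coefficients are at most `|Q|^s`. Since measures
decay geometrically along a point, these differences sum up: Dirac masses exist, are uniformly
bounded, and `δ_y - δ_x` has norm at most a constant times `d̂(x,y)^s`. The triangle inequality then
bounds the norm by the cost of any representation (`enorm_le_atomicNorm`).

Upper bound. The average `1_Q/|Q|` is the weighted mean of the averages of the children of `Q`.
Replace each child average by a Dirac mass at a point of the child, and move that mass to a point of
`Q` by a dipole of cost `O(|Q|^s)`. Iterating over `n` generations gives one Dirac mass in `Q` plus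
dipoles of total cost `O(|Q|^s)`, uniformly in `n`, with an error that is geometrically small in `n`
(`approx_average`, `approx_cell`). A unit vector is `|Q|^{-s}` times a difference of two such means
over children of the same `Q`, so the Dirac masses cancel, and its cost is bounded independently of
the wavelet. Truncating an `ℓ¹` vector, one approximates it up to half its norm at comparable cost.
Iterating on the remainder finishes the proof, thanks to countable subadditivity of the atomic norm
(`atomicNorm_le_tsum`).

Only two comparisons of the dipole weight are used, with the `ℓ¹` distance and with `d̂^s`;
`IsDipoleWeight` isolates them, so that both norms are treated at once. -/

noncomputable section

namespace DiracDipole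

/-! ### Geometry of the grid and of its points -/

section Grid

variable {Ω : Type*} [MeasurableSpace Ω] {μ : Measure Ω} (G : GoodGrid μ)

/-- The lower bound for the ratio of the measures of a child and its father. -/
def GoodGrid.ratioLow : ℝ := G.ratio.choose

/-- The upper bound for the ratio of the measures of a child and its father. -/
def GoodGrid.ratioUp : ℝ := G.ratio.choose_spec.choose

theorem GoodGrid.ratioLow_pos : 0 < G.ratioLow := G.ratio.choose_spec.choose_spec.1

theorem GoodGrid.ratioUp_pos : 0 < G.ratioUp := G.ratio.choose_spec.choose_spec.2.2.1

theorem GoodGrid.ratioUp_lt_one : G.ratioUp < 1 := G.ratio.choose_spec.choose_spec.2.2.2.1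

theorem GoodGrid.exists_parent {k : ℕ} (Q : G.Cell (k + 1)) : ∃ P : G.Cell k, Q.1 ⊆ P.1 := by
  obtain ⟨P, hP, h⟩ := G.nested k Q.1 Q.2
  exact ⟨⟨P, hP⟩, h⟩

theorem GoodGrid.ratio_bounds {k : ℕ} {P : G.Cell k} {Q : G.Cell (k + 1)} (h : Q.1 ⊆ P.1) :
    G.ratioLow ≤ μ.real Q.1 / μ.real P.1 ∧ μ.real Q.1 / μ.real P.1 ≤ G.ratioUp :=
  G.ratio.choose_spec.choose_spec.2.2.2.2 k P.1 P.2 Q.1 Q.2 h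

/-- A quotient with zero numerator or zero denominator is `0` in Lean, so the positive lower bound
on the ratio excludes both. -/
theorem GoodGrid.measure_pos_of_child {k : ℕ} {P : G.Cell k} {Q : G.Cell (k + 1)}
    (h : Q.1 ⊆ P.1) : 0 < μ.real Q.1 ∧ 0 < μ.real P.1 := by
  have h1 := G.ratioLow_pos.trans_le (G.ratio_bounds h).1
  constructor
  · refine lt_of_le_of_ne measureReal_nonneg fun h0 => ?_
    rw [← h0, zero_div] at h1
    exact h1.false
  · refine lt_of_le_of_ne measureReal_nonneg fun h0 => ?_
    rw [← h0, div_zero] at h1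
    exact h1.false

theorem GoodGrid.cell_zero_eq_univ (Q : G.Cell 0) : Q.1 = Set.univ := by
  exact Finset.mem_singleton.1 (G.part_zero ▸ Q.2 : Q.1 ∈ ({Set.univ} : Finset (Set Ω)))

instance : Subsingleton (G.Cell 0) :=
  ⟨fun P Q => Subtype.ext ((G.cell_zero_eq_univ P).trans (G.cell_zero_eq_univ Q).symm)⟩

/-- The only cell of level `0`. -/
def GoodGrid.root : G.Cell 0 := ⟨Set.univ, by rw [G.part_zero]; exact Finset.mem_singleton_self _⟩

variable {G}

theorem measureReal_inter_of_ne {k : ℕ} {P P' : G.Cell k} (h : P ≠ P') :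
    μ.real (P.1 ∩ P'.1) = 0 := by
  have := G.aedisjoint k P.2 P'.2 (fun h' => h (Subtype.ext h'))
  rw [measureReal_def, this, ENNReal.toReal_zero]

theorem exists_ancestor {k m : ℕ} (hkm : k ≤ m) (R : G.Cell m) : ∃ P : G.Cell k, R.1 ⊆ P.1 := by
  induction m, hkm using Nat.le_induction with
  | base => exact ⟨R, subset_rfl⟩
  | succ m _ ih =>
    obtain ⟨P, hP⟩ := G.exists_parent R
    obtain ⟨A, hA⟩ := ih P
    exact ⟨A, hP.trans hA⟩

theorem ae_exists_unique_cell (G : GoodGrid μ) (k : ℕ) :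
    ∀ᵐ x ∂μ, ∃ Q : G.Cell k, ∀ R : G.Cell k, x ∈ R.1 ↔ R = Q := by
  have h1 : ∀ᵐ x ∂μ, ∀ P P' : G.Cell k, P ≠ P' → ¬ (x ∈ P.1 ∩ P'.1) := by
    rw [ae_all_iff]; intro P
    rw [ae_all_iff]; intro P'
    by_cases h : P = P'
    · exact Eventually.of_forall fun x h' => absurd h h'
    · have := G.aedisjoint k P.2 P'.2 (fun h' => h (Subtype.ext h'))
      filter_upwards [measure_eq_zero_iff_ae_notMem.1 this] with x hx _
      exact hx
  filter_upwards [h1, G.ae_cover k] with x hx ⟨Q, hQ, hxQ⟩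
  refine ⟨⟨Q, hQ⟩, fun R => ⟨fun hR => ?_, fun hR => by rw [hR]; exact hxQ⟩⟩
  by_contra hne
  exact hx _ _ hne ⟨hR, hxQ⟩

theorem Point.ext_cell {x y : Point G} (h : ∀ n, x.cell n = y.cell n) : x = y := by
  cases x; cases y
  congr
  exact funext h

theorem dHat_nonneg (x y : Point G) : 0 ≤ dHat x y := by
  rw [dHat]
  split_ifs
  · exact measureReal_nonneg
  · exact le_rfl

/-- Two different points have a last common cell, the measure of which is their distance. -/
theorem eq_or_exists_dHat_eq (x y : Point G) :
    x = y ∨ ∃ n, x.cell n = y.cell n ∧ dHat x y = μ.real (x.cell n).1 := by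
  classical
  by_cases hn : ∃ n, x.cell (n + 1) ≠ y.cell (n + 1)
  · right
    refine ⟨Nat.find hn, ?_, by rw [dHat, dif_pos hn]⟩
    cases h : Nat.find hn with
    | zero => exact Subsingleton.elim _ _
    | succ m =>
      by_contra hne
      exact Nat.find_min hn (m := m) (by omega) hne
  · left
    push Not at hn
    refine Point.ext_cell fun n => ?_
    cases n with
    | zero => exact Subsingleton.elim _ _
    | succ n => exact hn n

variable [IsProbabilityMeasure μ]

theorem cell_measure_pos {k : ℕ} (Q : G.Cell k) : 0 < μ.real Q.1 := by
  cases k with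
  | zero => rw [G.cell_zero_eq_univ Q, probReal_univ]; exact one_pos
  | succ k =>
    obtain ⟨P, hP⟩ := G.exists_parent Q
    exact (G.measure_pos_of_child hP).1

theorem child_measure_le {k : ℕ} {P : G.Cell k} {Q : G.Cell (k + 1)} (h : Q.1 ⊆ P.1) :
    μ.real Q.1 ≤ G.ratioUp * μ.real P.1 :=
  (div_le_iff₀ (cell_measure_pos P)).1 (G.ratio_bounds h).2

theorem le_child_measure {k : ℕ} {P : G.Cell k} {Q : G.Cell (k + 1)} (h : Q.1 ⊆ P.1) :
    G.ratioLow * μ.real P.1 ≤ μ.real Q.1 :=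
  (le_div_iff₀ (cell_measure_pos P)).1 (G.ratio_bounds h).1

/-- A cell has positive measure and cannot lie in the null overlap of two cells. This replaces
genuine disjointness and makes ancestors unique. -/
theorem eq_of_subset {k m : ℕ} {P P' : G.Cell k} (R : G.Cell m) (h : R.1 ⊆ P.1)
    (h' : R.1 ⊆ P'.1) : P = P' := by
  by_contra hne
  have h1 : μ.real R.1 ≤ μ.real (P.1 ∩ P'.1) := measureReal_mono (Set.subset_inter h h')
  rw [measureReal_inter_of_ne hne] at h1
  exact (cell_measure_pos R).not_ge h1

theorem measureReal_inter_eq_zero {k m : ℕ} (hkm : k ≤ m) {P : G.Cell k} {R : G.Cell m}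
    (h : ¬ R.1 ⊆ P.1) : μ.real (P.1 ∩ R.1) = 0 := by
  obtain ⟨A, hA⟩ := exists_ancestor hkm R
  have hne : P ≠ A := by rintro rfl; exact h hA
  refine le_antisymm ?_ measureReal_nonneg
  rw [← measureReal_inter_of_ne hne]
  exact measureReal_mono (Set.inter_subset_inter_right _ hA)

/-- Almost every point of `Q` lies in a cell of the next level, whose father must be `Q`; without
children `Q` would be null. -/
theorem exists_child {k : ℕ} (Q : G.Cell k) : ∃ R : G.Cell (k + 1), R.1 ⊆ Q.1 := by
  by_contra! hno
  have h : ∀ᵐ x ∂μ, x ∉ Q.1 := by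
    filter_upwards [ae_exists_unique_cell G k, ae_exists_unique_cell G (k + 1)] with x
      ⟨P, hP⟩ ⟨R, hR⟩ hxQ
    obtain ⟨P', hP'⟩ := G.exists_parent R
    have h1 := (hP P').1 (hP' ((hR R).2 rfl))
    rw [h1, ← (hP Q).1 hxQ] at hP'
    exact hno R hP'
  have h0 := measure_eq_zero_iff_ae_notMem.2 h
  have := cell_measure_pos Q
  rw [measureReal_def, h0, ENNReal.toReal_zero] at this
  exact this.false

theorem Point.cell_eq_of_le {x y : Point G} {k n : ℕ} (hn : n ≤ k)
    (h : x.cell k = y.cell k) : x.cell n = y.cell n := by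
  induction k, hn using Nat.le_induction with
  | base => exact h
  | succ k _ ih =>
    exact ih (eq_of_subset (x.cell (k + 1)) (x.subset k) (h ▸ y.subset k))

theorem Point.measure_cell_succ_le (x : Point G) (k : ℕ) :
    μ.real (x.cell (k + 1)).1 ≤ G.ratioUp * μ.real (x.cell k).1 :=
  child_measure_le (x.subset k)

theorem Point.measure_cell_add_le (x : Point G) (k n : ℕ) :
    μ.real (x.cell (k + n)).1 ≤ G.ratioUp ^ n * μ.real (x.cell k).1 := by
  induction n with
  | zero => simp
  | succ n ih =>
    calc μ.real (x.cell (k + n + 1)).1 ≤ G.ratioUp * μ.real (x.cell (k + n)).1 :=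
          x.measure_cell_succ_le _
      _ ≤ G.ratioUp * (G.ratioUp ^ n * μ.real (x.cell k).1) :=
          mul_le_mul_of_nonneg_left ih G.ratioUp_pos.le
      _ = _ := by ring

theorem Point.measure_cell_anti (x : Point G) {k n : ℕ} (h : k ≤ n) :
    μ.real (x.cell n).1 ≤ μ.real (x.cell k).1 := by
  obtain ⟨i, rfl⟩ := Nat.exists_eq_add_of_le h
  refine (x.measure_cell_add_le k i).trans ?_
  exact mul_le_of_le_one_left measureReal_nonneg (pow_le_one₀ G.ratioUp_pos.le G.ratioUp_lt_one.le)

open Classical in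
/-- A child of `P` that contains the set `A` if there is one, and any child of `P` otherwise. -/
def childTowards (A : Set Ω) {k : ℕ} (P : G.Cell k) : G.Cell (k + 1) :=
  if h : ∃ R : G.Cell (k + 1), R.1 ⊆ P.1 ∧ A ⊆ R.1 then h.choose else (exists_child P).choose

theorem childTowards_subset (A : Set Ω) {k : ℕ} (P : G.Cell k) : (childTowards A P).1 ⊆ P.1 := by
  rw [childTowards]
  split_ifs with h
  · exact h.choose_spec.1
  · exact (exists_child P).choose_spec

theorem subset_childTowards {A : Set Ω} {k : ℕ} {P : G.Cell k}
    (h : ∃ R : G.Cell (k + 1), R.1 ⊆ P.1 ∧ A ⊆ R.1) : A ⊆ (childTowards A P).1 := by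
  rw [childTowards, dif_pos h]
  exact h.choose_spec.2

/-- The point obtained by descending from the root, staying above `A` as long as possible. -/
def pointTowards (G : GoodGrid μ) (A : Set Ω) : Point G where
  cell n := Nat.rec (motive := fun n => G.Cell n) G.root (fun _ P => childTowards A P) n
  subset _ := childTowards_subset A _

theorem exists_point {k : ℕ} (Q : G.Cell k) : ∃ x : Point G, x.cell k = Q := by
  refine ⟨pointTowards G Q.1, ?_⟩
  -- Down to level `k` the descent runs through the ancestors of `Q`; below that level the choice of
  -- children does not matter.
  have h : ∀ n ≤ k, Q.1 ⊆ ((pointTowards G Q.1).cell n).1 := by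
    intro n
    induction n with
    | zero => intro _; exact Set.subset_univ _
    | succ n ih =>
      intro hn
      refine subset_childTowards ?_
      obtain ⟨R, hR⟩ := exists_ancestor hn Q
      obtain ⟨P, hP⟩ := G.exists_parent R
      refine ⟨R, ?_, hR⟩
      have hPn : (pointTowards G Q.1).cell n = P :=
        eq_of_subset Q (ih (by omega)) (hR.trans hP)
      exact hP.trans_eq (congrArg Subtype.val hPn).symm
  exact eq_of_subset Q (h k le_rfl) subset_rfl

/-- A point of the cell `Q`. -/
def cellPoint {k : ℕ} (Q : G.Cell k) : Point G := (exists_point Q).choose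

theorem cellPoint_cell {k : ℕ} (Q : G.Cell k) : (cellPoint Q).cell k = Q :=
  (exists_point Q).choose_spec

instance : Nonempty (Point G) := ⟨cellPoint G.root⟩

theorem cellPoint_cell_parent {k : ℕ} {Q : G.Cell k} {R : G.Cell (k + 1)} (h : R.1 ⊆ Q.1) :
    (cellPoint R).cell k = Q :=
  eq_of_subset R (by have := (cellPoint R).subset k; rwa [cellPoint_cell] at this) h

/-- The last common cell has level at least `k`, and measures decrease along a point. -/
theorem dHat_le {x y : Point G} {k : ℕ} (h : x.cell k = y.cell k) :
    dHat x y ≤ μ.real (x.cell k).1 := by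
  classical
  rw [dHat]
  split_ifs with hn
  · refine x.measure_cell_anti ?_
    by_contra! hlt
    exact Nat.find_spec hn (Point.cell_eq_of_le hlt h)
  · exact measureReal_nonneg

end Grid

/-! ### Combinatorics of repeated halving -/

section Pairs

variable {α : Type*}

theorem mem_haarPairs {l : List α} {p : List α × List α} :
    p ∈ haarPairs l ↔ 2 ≤ l.length ∧ (p = (l.take (l.length / 2), l.drop (l.length / 2)) ∨
      p ∈ haarPairs (l.take (l.length / 2)) ∨ p ∈ haarPairs (l.drop (l.length / 2))) := by
  rw [haarPairs]
  split_ifs with h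
  · simp [h]
  · simp [h]

/-- Follows the recursion of `haarPairs`. The halves are available only for blocks of length at
least two, which they strictly shorten. -/
theorem halving_induction {p : List α → Prop}
    (h : ∀ l, (2 ≤ l.length → p (l.take (l.length / 2)) ∧ p (l.drop (l.length / 2))) → p l)
    (l : List α) : p l := by
  induction hl : l.length using Nat.strong_induction_on generalizing l with
  | _ n ih =>
    refine h l fun h2 => ⟨ih _ ?_ _ rfl, ih _ ?_ _ rfl⟩
    · simp only [List.length_take]; omega
    · simp only [List.length_drop]; omega

theorem haarPairs_sublist {l : List α} {p : List α × List α} (hp : p ∈ haarPairs l) :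
    (p.1 ++ p.2).Sublist l := by
  induction l using halving_induction with
  | h l ih =>
    obtain ⟨h2, rfl | h | h⟩ := mem_haarPairs.1 hp
    · simp
    · exact ((ih h2).1 h).trans (List.take_sublist _ _)
    · exact ((ih h2).2 h).trans (List.drop_sublist _ _)

theorem haarPairs_ne_nil {l : List α} {p : List α × List α} (hp : p ∈ haarPairs l) :
    p.1 ≠ [] ∧ p.2 ≠ [] := by
  induction l using halving_induction with
  | h l ih =>
    obtain ⟨h2, rfl | h | h⟩ := mem_haarPairs.1 hp
    · constructor <;>
      · rw [← List.length_pos_iff_ne_nil]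
        simp only [List.length_take, List.length_drop]
        omega
    · exact (ih h2).1 h
    · exact (ih h2).2 h

/-- No member of the pair `p` splits the union of the members of the pair `q`. -/
def ConstOn (p q : List α × List α) : Prop :=
  ∀ a ∈ q.1 ++ q.2, ∀ b ∈ q.1 ++ q.2, (a ∈ p.1 ↔ b ∈ p.1) ∧ (a ∈ p.2 ↔ b ∈ p.2)

theorem constOn_of_forall {p q : List α × List α} (u v : Prop)
    (h : ∀ a ∈ q.1 ++ q.2, (a ∈ p.1 ↔ u) ∧ (a ∈ p.2 ↔ v)) : ConstOn p q := fun a ha b hb =>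
  ⟨(h a ha).1.trans (h b hb).1.symm, (h a ha).2.trans (h b hb).2.symm⟩

/-- Follow the halving down to the first block in which the two pairs no longer belong to the same
half. Either one pair is the splitting of that block and the other lies inside one half, or they lie
in opposite halves. -/
theorem haarPairs_laminar {l : List α} (hl : l.Nodup) {p q : List α × List α}
    (hp : p ∈ haarPairs l) (hq : q ∈ haarPairs l) (hne : p ≠ q) :
    ConstOn p q ∨ ConstOn q p := by
  induction l using halving_induction with
  | h l ih =>
    have hd : ∀ a, a ∈ l.take (l.length / 2) → a ∈ l.drop (l.length / 2) → False := by
      rw [← List.take_append_drop (l.length / 2) l] at hl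
      exact fun a h1 h2 => List.disjoint_of_nodup_append hl h1 h2
    have key1 : ∀ {r : List α × List α}, r ∈ haarPairs (l.take (l.length / 2)) →
        ConstOn (l.take (l.length / 2), l.drop (l.length / 2)) r := fun hr =>
      constOn_of_forall True False fun a ha => by
        have h1 := (haarPairs_sublist hr).subset ha
        exact ⟨iff_of_true h1 trivial, iff_of_false (hd a h1) id⟩
    have key2 : ∀ {r : List α × List α}, r ∈ haarPairs (l.drop (l.length / 2)) →
        ConstOn (l.take (l.length / 2), l.drop (l.length / 2)) r := fun hr =>
      constOn_of_forall False True fun a ha => by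
        have h1 := (haarPairs_sublist hr).subset ha
        exact ⟨iff_of_false (fun h => hd a h h1) id, iff_of_true h1 trivial⟩
    have key3 : ∀ {r t : List α × List α}, r ∈ haarPairs (l.take (l.length / 2)) →
        t ∈ haarPairs (l.drop (l.length / 2)) → ConstOn r t := fun hr ht =>
      constOn_of_forall False False fun a ha => by
        have h1 := (haarPairs_sublist ht).subset ha
        exact ⟨iff_of_false (fun h => hd a ((haarPairs_sublist hr).subset
          (List.mem_append_left _ h)) h1) id, iff_of_false (fun h => hd a
          ((haarPairs_sublist hr).subset (List.mem_append_right _ h)) h1) id⟩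
    obtain ⟨h2, hp'⟩ := mem_haarPairs.1 hp
    obtain ⟨-, hq'⟩ := mem_haarPairs.1 hq
    rcases hp' with hp' | hp' | hp' <;> rcases hq' with hq' | hq' | hq'
    · exact absurd (hp'.trans hq'.symm) hne
    · exact Or.inl (hp' ▸ key1 hq')
    · exact Or.inl (hp' ▸ key2 hq')
    · exact Or.inr (hq' ▸ key1 hp')
    · exact (ih h2).1 (hl.sublist (List.take_sublist _ _)) hp' hq'
    · exact Or.inl (key3 hp' hq')
    · exact Or.inr (hq' ▸ key2 hp')
    · exact Or.inr (key3 hq' hp')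
    · exact (ih h2).2 (hl.sublist (List.drop_sublist _ _)) hp' hq'

end Pairs

/-! ### Families of cells -/

section Families

variable {Ω : Type*} [MeasurableSpace Ω] {μ : Measure Ω} {G : GoodGrid μ}

/-- The total measure of a family of cells. -/
def mass {k : ℕ} (S : List (G.Cell k)) : ℝ := (S.map fun P => μ.real P.1).sum

theorem measure_le_mass {k : ℕ} {S : List (G.Cell k)} {P : G.Cell k} (hP : P ∈ S) :
    μ.real P.1 ≤ mass S :=
  List.single_le_sum (by
    intro x hx
    obtain ⟨P, -, rfl⟩ := List.mem_map.1 hx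
    exact measureReal_nonneg) _ (List.mem_map.2 ⟨P, hP, rfl⟩)

variable {H : HaarSystem G}

theorem mem_pair_subset {k : ℕ} {Q : G.Cell k}
    {T : List (G.Cell (k + 1)) × List (G.Cell (k + 1))} (hT : T ∈ haarPairs (H.order k Q))
    {R : G.Cell (k + 1)} (hR : R ∈ T.1 ++ T.2) : R.1 ⊆ Q.1 :=
  (H.mem_order k Q R).1 ((haarPairs_sublist hT).subset hR)

theorem nodup_pair {k : ℕ} {Q : G.Cell k} {T : List (G.Cell (k + 1)) × List (G.Cell (k + 1))}
    (hT : T ∈ haarPairs (H.order k Q)) : (T.1 ++ T.2).Nodup :=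
  (H.nodup k Q).sublist (haarPairs_sublist hT)

end Families

/-! ### The bilinear pairing and the orthogonality of the wavelets -/

section Pairing

variable {Ω : Type*} [MeasurableSpace Ω] {μ : Measure Ω} [IsProbabilityMeasure μ]

theorem norm_integral_mul_le (f g : Lp ℂ ∞ μ) : ‖∫ x, f x * g x ∂μ‖ ≤ ‖f‖ * ‖g‖ := by
  have h : ∀ u : Lp ℂ ∞ μ, ∀ᵐ x ∂μ, ‖u x‖ ≤ ‖u‖ := fun u => by
    have hu : eLpNorm u ∞ μ ≠ ∞ := Lp.eLpNorm_ne_top u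
    filter_upwards [ae_le_eLpNormEssSup (f := u) (μ := μ)] with x hx
    rw [Lp.norm_def, eLpNorm_exponent_top] at *
    rw [← toReal_enorm]
    exact ENNReal.toReal_mono hu hx
  refine (norm_integral_le_of_norm_le_const (C := ‖f‖ * ‖g‖) ?_).trans_eq (by simp)
  filter_upwards [h f, h g] with x h1 h2
  rw [norm_mul]
  gcongr

variable (μ) in
/-- The bilinear pairing `∫ f g dμ` of bounded functions. -/
def pairing : Lp ℂ ∞ μ →L[ℂ] Lp ℂ ∞ μ →L[ℂ] ℂ :=
  LinearMap.mkContinuous₂ (LinearMap.mk₂ ℂ (fun f g : Lp ℂ ∞ μ => ∫ x, f x * g x ∂μ)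
    (fun f f' g => by
      rw [← integral_add (integrable_mul g _) (integrable_mul g _)]
      refine integral_congr_ae ?_
      filter_upwards [Lp.coeFn_add f f'] with x hx
      rw [hx, Pi.add_apply, add_mul])
    (fun a f g => by
      rw [smul_eq_mul, ← integral_const_mul]
      refine integral_congr_ae ?_
      filter_upwards [Lp.coeFn_smul a f] with x hx
      rw [hx, Pi.smul_apply, smul_eq_mul, mul_assoc])
    (fun f g g' => by
      rw [← integral_add (integrable_mul _ f) (integrable_mul _ f)]
      refine integral_congr_ae ?_
      filter_upwards [Lp.coeFn_add g g'] with x hx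
      rw [hx, Pi.add_apply, mul_add])
    (fun a f g => by
      rw [smul_eq_mul, ← integral_const_mul]
      refine integral_congr_ae ?_
      filter_upwards [Lp.coeFn_smul a g] with x hx
      rw [hx, Pi.smul_apply, smul_eq_mul, mul_left_comm])) 1
    fun f g => by
      rw [one_mul, LinearMap.mk₂_apply]
      exact norm_integral_mul_le f g

theorem pairing_apply (f g : Lp ℂ ∞ μ) : pairing μ f g = ∫ x, f x * g x ∂μ := rfl

theorem pairing_comm (f g : Lp ℂ ∞ μ) : pairing μ f g = pairing μ g f := by
  simp only [pairing_apply, mul_comm]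

theorem pairing_indicator {A B : Set Ω} (hA : MeasurableSet A) (hB : MeasurableSet B) :
    pairing μ (indicatorConstLp ∞ hA (measure_ne_top μ A) 1)
      (indicatorConstLp ∞ hB (measure_ne_top μ B) 1) = μ.real (A ∩ B) := by
  rw [pairing_apply]
  have : ∀ᵐ x ∂μ, indicatorConstLp ∞ hA (measure_ne_top μ A) (1 : ℂ) x *
      indicatorConstLp ∞ hB (measure_ne_top μ B) (1 : ℂ) x
        = (A ∩ B).indicator (fun _ => (1 : ℂ)) x := by
    filter_upwards [indicatorConstLp_coeFn (p := ∞) (hs := hA) (hμs := measure_ne_top μ A)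
      (c := (1 : ℂ)), indicatorConstLp_coeFn (p := ∞) (hs := hB) (hμs := measure_ne_top μ B)
      (c := (1 : ℂ))] with x h1 h2
    rw [h1, h2]
    by_cases hxA : x ∈ A <;> by_cases hxB : x ∈ B <;> simp [hxA, hxB]
  rw [integral_congr_ae this, integral_indicator_const _ (hA.inter hB)]
  simp

variable {G : GoodGrid μ}

theorem oneFun_eq_cellFun (Q : G.Cell 0) : oneFun μ = cellFun G Q := by
  have h := G.cell_zero_eq_univ Q
  obtain ⟨Q, hQ⟩ := Q
  subst h
  rfl

theorem pairing_cellFun_of_subset {k m : ℕ} {P : G.Cell k} {R : G.Cell m} (h : R.1 ⊆ P.1) :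
    pairing μ (cellFun G P) (cellFun G R) = μ.real R.1 := by
  rw [cellFun, cellFun, pairing_indicator, Set.inter_eq_right.2 h]

theorem pairing_cellFun_of_not_subset {k m : ℕ} (hkm : k ≤ m) {P : G.Cell k} {R : G.Cell m}
    (h : ¬ R.1 ⊆ P.1) : pairing μ (cellFun G P) (cellFun G R) = 0 := by
  rw [cellFun, cellFun, pairing_indicator, measureReal_inter_eq_zero hkm h, Complex.ofReal_zero]

theorem mass_pos {k : ℕ} {S : List (G.Cell k)} (hS : S ≠ []) : 0 < mass S :=
  List.sum_pos _ (by
    intro x hx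
    obtain ⟨P, -, rfl⟩ := List.mem_map.1 hx
    exact cell_measure_pos P) (by rwa [ne_eq, List.map_eq_nil_iff])

theorem blockFun_eq {k : ℕ} (S : List (G.Cell k)) :
    blockFun G S = ((mass S : ℝ) : ℂ)⁻¹ • (S.map fun P => cellFun G P).sum := rfl

/-- If a linear map takes the values `c|P|` on the characteristic functions of the cells of a
family, then it takes the value `c` on the normalised characteristic function of the family. -/
theorem apply_blockFun {F E : Type*} [AddCommGroup E] [Module ℂ E] [FunLike F (Lp ℂ ∞ μ) E]
    [LinearMapClass F ℂ (Lp ℂ ∞ μ) E] (f : F) {k : ℕ} {S : List (G.Cell k)} (hS : S ≠ []) (c : E)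
    (h : ∀ P ∈ S, f (cellFun G P) = ((μ.real P.1 : ℝ) : ℂ) • c) : f (blockFun G S) = c := by
  have h1 : f (S.map fun P => cellFun G P).sum = ((mass S : ℝ) : ℂ) • c := by
    clear hS
    induction S with
    | nil => simp [mass]
    | cons P S ih =>
      rw [List.map_cons, List.sum_cons, map_add, h P List.mem_cons_self,
        ih fun R hR => h R (List.mem_cons_of_mem _ hR), ← add_smul]
      simp [mass]
  rw [blockFun_eq, map_smul, h1, smul_smul, inv_mul_cancel₀, one_smul]
  exact_mod_cast (mass_pos hS).ne'

/-- The value at a cell of the normalised characteristic function of a family of cells. -/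
def blockVal {k : ℕ} (S : List (G.Cell k)) (R : G.Cell k) : ℂ :=
  open Classical in if R ∈ S then ((mass S : ℝ) : ℂ)⁻¹ else 0

theorem pairing_blockFun_cellFun {k : ℕ} {S : List (G.Cell k)} (hS : S.Nodup) (R : G.Cell k) :
    pairing μ (blockFun G S) (cellFun G R) = ((μ.real R.1 : ℝ) : ℂ) * blockVal S R := by
  classical
  have h1 : pairing μ (S.map fun P => cellFun G P).sum (cellFun G R) =
      if R ∈ S then ((μ.real R.1 : ℝ) : ℂ) else 0 := by
    induction S with
    | nil => simp
    | cons P S ih =>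
      rw [List.map_cons, List.sum_cons, map_add, add_apply,
        ih hS.of_cons]
      by_cases hPR : R = P
      · subst hPR
        rw [if_neg (List.nodup_cons.1 hS).1, if_pos List.mem_cons_self, add_zero,
          pairing_cellFun_of_subset subset_rfl]
      · rw [pairing_cellFun_of_not_subset le_rfl fun h => hPR (eq_of_subset R subset_rfl h),
          zero_add]
        simp [hPR]
  rw [blockFun_eq, map_smul, smul_apply, h1, blockVal, smul_eq_mul]
  split_ifs <;> ring

/-- A function with the same mean `c` on all the cells involved sees `c` on both normalised blocks.
Every orthogonality relation between wavelets rests on this cancellation. -/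
theorem pairing_haar_eq_zero {k : ℕ} (f : Lp ℂ ∞ μ) (c : ℂ)
    {T : List (G.Cell k) × List (G.Cell k)} (hT : T.1 ≠ [] ∧ T.2 ≠ [])
    (h : ∀ R ∈ T.1 ++ T.2, pairing μ f (cellFun G R) = ((μ.real R.1 : ℝ) : ℂ) * c) :
    pairing μ f (haar G T) = 0 := by
  rw [haar, map_sub,
    apply_blockFun _ hT.1 c fun R hR => h R (List.mem_append_left _ hR),
    apply_blockFun _ hT.2 c fun R hR => h R (List.mem_append_right _ hR), sub_self]

variable {H : HaarSystem G}

/-- The wavelet with a given index. -/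
def HaarSystem.wavelet (H : HaarSystem G) (i : H.Idx) : Lp ℂ ∞ μ := haar G i.2.2.1

theorem pairing_cellFun_haar {m k : ℕ} (hmk : m ≤ k) (P : G.Cell m) {Q : G.Cell k}
    {T : List (G.Cell (k + 1)) × List (G.Cell (k + 1))} (hT : T ∈ haarPairs (H.order k Q)) :
    pairing μ (cellFun G P) (haar G T) = 0 := by
  by_cases h : Q.1 ⊆ P.1
  · refine pairing_haar_eq_zero _ 1 (haarPairs_ne_nil hT) fun R hR => ?_
    rw [pairing_cellFun_of_subset ((mem_pair_subset hT hR).trans h), mul_one]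
  · refine pairing_haar_eq_zero _ 0 (haarPairs_ne_nil hT) fun R hR => ?_
    rw [pairing_cellFun_of_not_subset (hmk.trans k.le_succ), mul_zero]
    intro hRP
    obtain ⟨A, hA⟩ := exists_ancestor hmk Q
    rw [eq_of_subset R hRP ((mem_pair_subset hT hR).trans hA)] at h
    exact h hA

theorem pairing_oneFun_haar (i : H.Idx) : pairing μ (oneFun μ) (H.wavelet i) = 0 := by
  rw [oneFun_eq_cellFun G.root]
  exact pairing_cellFun_haar (Nat.zero_le _) _ i.2.2.2

/-- The coarser wavelet is a combination of indicators of cells of level `k + 1 ≤ m`, each of them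
almost everywhere constant on the cell carrying the finer wavelet. -/
theorem pairing_haar_haar_of_lt {k m : ℕ} (hkm : k < m)
    {S : List (G.Cell (k + 1)) × List (G.Cell (k + 1))}
    {Q : G.Cell m} {T : List (G.Cell (m + 1)) × List (G.Cell (m + 1))}
    (hT : T ∈ haarPairs (H.order m Q)) : pairing μ (haar G S) (haar G T) = 0 := by
  have h : ∀ U : List (G.Cell (k + 1)), pairing μ (blockFun G U) (haar G T) = 0 := fun U => by
    rw [blockFun_eq, map_smul, smul_apply]
    convert smul_zero _
    induction U with
    | nil => simp
    | cons P U ih =>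
      rw [List.map_cons, List.sum_cons, map_add, add_apply, ih,
        pairing_cellFun_haar hkm P hT, add_zero]
  rw [haar, map_sub, sub_apply, h, h, sub_zero]

theorem pairing_haar_cellFun {k : ℕ} {S : List (G.Cell k) × List (G.Cell k)}
    (hS : (S.1 ++ S.2).Nodup) (R : G.Cell k) :
    pairing μ (haar G S) (cellFun G R) =
      ((μ.real R.1 : ℝ) : ℂ) * (blockVal S.1 R - blockVal S.2 R) := by
  rw [haar, map_sub, sub_apply,
    pairing_blockFun_cellFun (List.Nodup.of_append_left hS),
    pairing_blockFun_cellFun (List.Nodup.of_append_right hS), mul_sub]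

theorem pairing_haar_haar_of_constOn {k : ℕ} {S T : List (G.Cell k) × List (G.Cell k)}
    (hS : (S.1 ++ S.2).Nodup) (hT : T.1 ≠ [] ∧ T.2 ≠ []) (h : ConstOn S T) :
    pairing μ (haar G S) (haar G T) = 0 := by
  obtain ⟨R₀, hR₀⟩ := List.exists_mem_of_ne_nil _ hT.1
  refine pairing_haar_eq_zero _ (blockVal S.1 R₀ - blockVal S.2 R₀) hT fun R hR => ?_
  rw [pairing_haar_cellFun hS]
  have := h R hR R₀ (List.mem_append_left _ hR₀)
  simp only [blockVal, this.1, this.2]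

theorem pairing_haar_self {k : ℕ} {S : List (G.Cell k) × List (G.Cell k)}
    (hS : (S.1 ++ S.2).Nodup) (hS' : S.1 ≠ [] ∧ S.2 ≠ []) :
    pairing μ (haar G S) (haar G S) = (((mass S.1)⁻¹ + (mass S.2)⁻¹ : ℝ) : ℂ) := by
  have hd := List.disjoint_of_nodup_append hS
  have h : pairing μ (haar G S) (blockFun G S.1 - blockFun G S.2) =
      (((mass S.1)⁻¹ + (mass S.2)⁻¹ : ℝ) : ℂ) := by
    rw [map_sub, apply_blockFun _ hS'.1 ((mass S.1 : ℝ) : ℂ)⁻¹ fun R hR => ?_,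
      apply_blockFun _ hS'.2 (-((mass S.2 : ℝ) : ℂ)⁻¹) fun R hR => ?_]
    · push_cast; ring
    · rw [pairing_haar_cellFun hS, blockVal, blockVal, if_neg fun h => hd h hR, if_pos hR,
        zero_sub, smul_eq_mul]
    · rw [pairing_haar_cellFun hS, blockVal, blockVal, if_neg fun h => hd hR h, if_pos hR,
        sub_zero, smul_eq_mul]
  exact h

theorem pairing_wavelet_of_ne {i j : H.Idx} (hij : i ≠ j) :
    pairing μ (H.wavelet i) (H.wavelet j) = 0 := by
  obtain ⟨k, Q, S, hS⟩ := i
  obtain ⟨m, P, T, hT⟩ := j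
  simp only [HaarSystem.wavelet]
  rcases lt_trichotomy k m with h | h | h
  · exact pairing_haar_haar_of_lt h hT
  · subst h
    by_cases hQP : Q = P
    · subst hQP
      have hne : S ≠ T := by rintro rfl; exact hij rfl
      rcases haarPairs_laminar (H.nodup k Q) hS hT hne with h | h
      · exact pairing_haar_haar_of_constOn (nodup_pair hS) (haarPairs_ne_nil hT) h
      · rw [pairing_comm]
        exact pairing_haar_haar_of_constOn (nodup_pair hT) (haarPairs_ne_nil hS) h
    · refine pairing_haar_haar_of_constOn (nodup_pair hS) (haarPairs_ne_nil hT) ?_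
      have : ∀ a ∈ T.1 ++ T.2, a ∉ S.1 ∧ a ∉ S.2 := by
        intro a ha
        rw [← not_or, ← List.mem_append]
        intro ha'
        exact hQP (eq_of_subset a (mem_pair_subset hS ha') (mem_pair_subset hT ha))
      intro a ha b hb
      simp [this a ha, this b hb]
  · rw [pairing_comm]
    exact pairing_haar_haar_of_lt h hS

/-- The square of the `L²` norm of a wavelet. -/
def HaarSystem.waveletSq (H : HaarSystem G) (i : H.Idx) : ℝ :=
  (mass i.2.2.1.1)⁻¹ + (mass i.2.2.1.2)⁻¹

theorem pairing_wavelet_self (i : H.Idx) :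
    pairing μ (H.wavelet i) (H.wavelet i) = ((H.waveletSq i : ℝ) : ℂ) :=
  pairing_haar_self (nodup_pair i.2.2.2) (haarPairs_ne_nil i.2.2.2)

theorem waveletSq_pos (i : H.Idx) : 0 < H.waveletSq i :=
  add_pos (inv_pos.2 (mass_pos (haarPairs_ne_nil i.2.2.2).1))
    (inv_pos.2 (mass_pos (haarPairs_ne_nil i.2.2.2).2))

/-- Each of the two blocks contains a child of `Q`, hence has mass at least `ratioLow * |Q|`. -/
theorem measure_mul_waveletSq_le (i : H.Idx) :
    μ.real i.2.1.1 * H.waveletSq i ≤ 2 * G.ratioLow⁻¹ := by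
  obtain ⟨k, Q, S, hS⟩ := i
  have h : ∀ U : List (G.Cell (k + 1)), U ≠ [] → (∀ R ∈ U, R.1 ⊆ Q.1) →
      μ.real Q.1 * (mass U)⁻¹ ≤ G.ratioLow⁻¹ := fun U hU hUQ => by
    obtain ⟨R, hR⟩ := List.exists_mem_of_ne_nil _ hU
    rw [← div_eq_mul_inv, div_le_iff₀ (mass_pos hU), inv_mul_eq_div, le_div_iff₀ G.ratioLow_pos,
      mul_comm]
    exact (le_child_measure (hUQ R hR)).trans (measure_le_mass hR)
  have h1 := h S.1 (haarPairs_ne_nil hS).1 fun R hR =>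
    mem_pair_subset hS (List.mem_append_left _ hR)
  have h2 := h S.2 (haarPairs_ne_nil hS).2 fun R hR =>
    mem_pair_subset hS (List.mem_append_right _ hR)
  simp only [HaarSystem.waveletSq]
  linarith

theorem sum_children_cellFun {k : ℕ} (Q : G.Cell k) :
    ((H.order k Q).map fun P => cellFun G P).sum = cellFun G Q := by
  classical
  have h1 : ((H.order k Q).map fun P => cellFun G P).sum =
      ∑ R ∈ (H.order k Q).toFinset, cellFun G R :=
    (List.sum_toFinset _ (H.nodup k Q)).symm
  rw [h1]
  refine Lp.ext ?_
  have hc : ∀ᵐ x ∂μ, ∀ R : G.Cell (k + 1), cellFun G R x = R.1.indicator (fun _ => (1 : ℂ)) x :=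
    ae_all_iff.2 fun R => indicatorConstLp_coeFn
  filter_upwards [hc, indicatorConstLp_coeFn (p := ∞) (hs := G.measurableSet_of_mem k Q.1 Q.2)
    (hμs := measure_ne_top μ Q.1) (c := (1 : ℂ)), ae_exists_unique_cell G k,
    ae_exists_unique_cell G (k + 1),
    Lp.coeFn_finsetSum (H.order k Q).toFinset fun R => cellFun G R]
    with x h2 h3 ⟨P, hP⟩ ⟨R, hR⟩ h4
  rw [h4, cellFun, h3, Finset.sum_apply]
  simp only [h2, Set.indicator_apply, hR, hP]
  rw [Finset.sum_ite_eq']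
  simp only [List.mem_toFinset, H.mem_order]
  refine if_congr ⟨fun h => ?_, fun h => ?_⟩ rfl rfl
  · exact (hP Q).1 (h ((hR R).2 rfl))
  · obtain ⟨P', hP'⟩ := G.exists_parent R
    have := (hP P').1 (hP' ((hR R).2 rfl))
    rwa [h, ← this]

/-- Integrate `sum_children_cellFun`; the root cell plays the role of the constant `1`. -/
theorem mass_order {k : ℕ} (Q : G.Cell k) : mass (H.order k Q) = μ.real Q.1 := by
  have h1 : ∀ U : List (G.Cell (k + 1)),
      pairing μ (cellFun G G.root) (U.map fun P => cellFun G P).sum = ((mass U : ℝ) : ℂ) := by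
    intro U
    induction U with
    | nil => simp [mass]
    | cons P U ih =>
      rw [List.map_cons, List.sum_cons, map_add, ih,
        pairing_cellFun_of_subset (Set.subset_univ _)]
      simp [mass]
  have h2 := h1 (H.order k Q)
  rw [sum_children_cellFun, pairing_cellFun_of_subset (Set.subset_univ _)] at h2
  exact_mod_cast h2.symm

theorem order_ne_nil {k : ℕ} (Q : G.Cell k) : H.order k Q ≠ [] := by
  obtain ⟨R, hR⟩ := exists_child Q
  exact List.ne_nil_of_mem ((H.mem_order k Q R).2 hR)

/-- The normalised characteristic function `1_Q / |Q|` of a cell. -/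
def cellAvg (G : GoodGrid μ) {k : ℕ} (Q : G.Cell k) : Lp ℂ ∞ μ :=
  (((μ.real Q.1 : ℝ) : ℂ)⁻¹) • cellFun G Q

theorem blockFun_order {k : ℕ} (Q : G.Cell k) : blockFun G (H.order k Q) = cellAvg G Q := by
  rw [blockFun_eq, mass_order, sum_children_cellFun, cellAvg]

theorem blockFun_singleton {k : ℕ} (Q : G.Cell k) : blockFun G [Q] = cellAvg G Q := by
  simp [blockFun_eq, mass, cellAvg]

theorem length_order_le {k : ℕ} (Q : G.Cell k) :
    ((H.order k Q).length : ℝ) ≤ G.ratioLow⁻¹ := by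
  have h : ∀ U : List (G.Cell (k + 1)), (∀ R ∈ U, R.1 ⊆ Q.1) →
      U.length * (G.ratioLow * μ.real Q.1) ≤ mass U := fun U => by
    induction U with
    | nil => simp [mass]
    | cons P U ih =>
      intro hU
      have h1 := ih fun R hR => hU R (List.mem_cons_of_mem _ hR)
      have h2 := le_child_measure (hU P List.mem_cons_self)
      simp only [mass, List.map_cons, List.sum_cons, List.length_cons, Nat.cast_add,
        Nat.cast_one] at h1 ⊢
      linarith
  have h1 := h (H.order k Q) fun R hR => (H.mem_order k Q R).1 hR
  rw [mass_order, ← mul_assoc] at h1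
  have h2 := (le_of_mul_le_mul_right (h1.trans_eq (one_mul _).symm) (cell_measure_pos Q))
  rwa [← one_div, le_div_iff₀ G.ratioLow_pos]

end Pairing

/-! ### The `ℓ¹` model of `B^{-s}_{1,1}` -/

section

theorem hasSum_option {α M : Type*} [AddCommMonoid M] [TopologicalSpace M] [ContinuousAdd M]
    {f : Option α → M} {a : M} (h : HasSum (fun i => f (some i)) a) : HasSum f (f none + a) := by
  classical
  have h1 : HasSum (fun o : Option α => if o = none then f none else 0) (f none) :=
    hasSum_ite_eq none (f none)
  have h2 : HasSum (fun o : Option α => o.elim 0 fun i => f (some i)) a := by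
    refine ((Option.some_injective α).hasSum_iff fun o ho => ?_).1 h
    cases o with
    | none => rfl
    | some i => exact absurd ⟨i, rfl⟩ ho
  refine (h1.add h2).congr_fun fun o => ?_
  cases o <;> simp

variable {Ω : Type*} [MeasurableSpace Ω] {μ : Measure Ω} {G : GoodGrid μ} (H : HaarSystem G)

/-- The indices of the wavelets that live on cells of level less than `N`. -/
def HaarSystem.box (N : ℕ) : Finset H.Idx :=
  (Finset.range N).sigma fun _ => Finset.univ.sigma fun _ => Finset.univ

variable {H}

theorem sum_box {M : Type*} [AddCommMonoid M] (f : H.Idx → M) (N : ℕ) :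
    ∑ k ∈ Finset.range N, ∑ Q : G.Cell k, ∑ S : haarPairs (H.order k Q), f ⟨k, Q, S⟩ =
      ∑ i ∈ H.box N, f i := by
  rw [HaarSystem.box, Finset.sum_sigma]
  refine Finset.sum_congr rfl fun k _ => ?_
  rw [Finset.sum_sigma]

theorem mem_box {i : H.Idx} {N : ℕ} : i ∈ H.box N ↔ i.1 < N := by
  simp [HaarSystem.box]

/-- Links the partial sums by levels, which appear in the definitions, to unconditional sums. -/
theorem tendsto_insertNone_box :
    Tendsto (fun N => Finset.insertNone (H.box N)) atTop atTop := by
  refine tendsto_atTop_finset_of_monotone (fun M N h => ?_) fun o => ?_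
  · exact Finset.insertNone.monotone fun i hi => mem_box.2 ((mem_box.1 hi).trans_le h)
  · cases o with
    | none => exact ⟨0, by simp⟩
    | some i => exact ⟨i.1 + 1, by simp [mem_box]⟩

/-- A bound for the unit functionals. -/
def GoodGrid.unitBound (G : GoodGrid μ) : ℝ := 1 + 2 * G.ratioLow⁻¹

theorem one_le_unitBound : 1 ≤ G.unitBound := by
  have := inv_pos.2 G.ratioLow_pos
  rw [GoodGrid.unitBound]
  linarith

/-- The space of absolutely summable families of coefficients; the index `none` belongs to the
constant function. -/
abbrev HaarSystem.Coeff (H : HaarSystem G) : Type _ := lp (fun _ : Option H.Idx => ℂ) 1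

theorem summable_norm_coeff (a : H.Coeff) : Summable fun o => ‖a o‖ := by
  simpa using (lp.memℓp a).summable (by simp)

theorem norm_coeff (a : H.Coeff) : ‖a‖ = ∑' o, ‖a o‖ := by
  simpa using lp.norm_eq_tsum_rpow (p := 1) (by simp) a

theorem enorm_coeff (a : H.Coeff) : ‖a‖ₑ = ∑' o, ‖a o‖ₑ := by
  rw [← ofReal_norm, norm_coeff, ENNReal.ofReal_tsum_of_nonneg (fun _ => norm_nonneg _)
    (summable_norm_coeff a)]
  simp only [ofReal_norm]

theorem enorm_coeff_eq (a : H.Coeff) : ‖a‖ₑ = ‖a none‖ₑ + ∑' i, ‖a (some i)‖ₑ := by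
  rw [enorm_coeff]
  exact (hasSum_option (f := fun o => ‖a o‖ₑ) ENNReal.summable.hasSum).tsum_eq

variable [IsProbabilityMeasure μ] {s : ℝ}

theorem isFunSeries_iff {ψ : Lp ℂ ∞ μ} {cI : ℂ} {c : H.Idx → ℂ} :
    H.IsFunSeries s ψ cI c ↔ Tendsto (fun N => cI • oneFun μ + ∑ i ∈ H.box N,
      (((μ.real i.2.1.1 ^ (1 + s) : ℝ) : ℂ) * c i) • H.wavelet i) atTop (𝓝 ψ) := by
  simp only [HaarSystem.IsFunSeries, ← sum_box]
  rfl

theorem pairing_oneFun_self : pairing μ (oneFun μ) (oneFun μ) = 1 := by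
  rw [oneFun, pairing_indicator, Set.inter_self, probReal_univ, Complex.ofReal_one]

theorem pairing_oneFun_of_isFunSeries {ψ : Lp ℂ ∞ μ} {cI : ℂ} {c : H.Idx → ℂ}
    (h : H.IsFunSeries s ψ cI c) : pairing μ ψ (oneFun μ) = cI := by
  have h1 := (((pairing μ).flip (oneFun μ)).continuous.tendsto ψ).comp (isFunSeries_iff.1 h)
  refine tendsto_nhds_unique h1 (tendsto_const_nhds.congr fun N => ?_)
  simp only [Function.comp_apply, map_add, map_smul, map_sum, ContinuousLinearMap.flip_apply]
  rw [pairing_oneFun_self, Finset.sum_eq_zero fun i _ => by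
    rw [pairing_comm, pairing_oneFun_haar, smul_zero]]
  simp

/-- The pairing is continuous on `L^∞`, and by orthogonality its values on the partial sums are
constant once the level of `j` is reached. -/
theorem pairing_wavelet_of_isFunSeries {ψ : Lp ℂ ∞ μ} {cI : ℂ} {c : H.Idx → ℂ}
    (h : H.IsFunSeries s ψ cI c) (j : H.Idx) : pairing μ ψ (H.wavelet j) =
      ((μ.real j.2.1.1 ^ (1 + s) : ℝ) : ℂ) * c j * ((H.waveletSq j : ℝ) : ℂ) := by
  have h1 := (((pairing μ).flip (H.wavelet j)).continuous.tendsto ψ).comp (isFunSeries_iff.1 h)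
  refine tendsto_nhds_unique h1 (tendsto_const_nhds.congr' ?_)
  filter_upwards [eventually_gt_atTop j.1] with N hN
  simp only [Function.comp_apply, map_add, map_smul, map_sum, ContinuousLinearMap.flip_apply]
  rw [pairing_oneFun_haar, smul_zero, zero_add, Finset.sum_eq_single_of_mem j (mem_box.2 hN)
    fun i _ hij => by rw [pairing_wavelet_of_ne hij, smul_zero], pairing_wavelet_self,
    smul_eq_mul]

theorem oneFun_mem_besov : oneFun μ ∈ H.besov s := by
  refine ⟨1, 0, isFunSeries_iff.2 ?_, 0, by simp⟩
  simp

theorem wavelet_mem_besov (j : H.Idx) : H.wavelet j ∈ H.besov s := by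
  classical
  refine ⟨0, Pi.single j (((μ.real j.2.1.1 ^ (1 + s) : ℝ) : ℂ)⁻¹), isFunSeries_iff.2 ?_,
    ‖((μ.real j.2.1.1 ^ (1 + s) : ℝ) : ℂ)⁻¹‖, fun i => ?_⟩
  · refine tendsto_const_nhds.congr' ?_
    filter_upwards [eventually_gt_atTop j.1] with N hN
    rw [zero_smul, zero_add, Finset.sum_eq_single_of_mem j (mem_box.2 hN)
      fun i _ hij => by rw [Pi.single_eq_of_ne hij, mul_zero, zero_smul], Pi.single_eq_same,
      mul_inv_cancel₀, one_smul]
    exact_mod_cast (Real.rpow_pos_of_pos (cell_measure_pos _) _).ne'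
  · rcases eq_or_ne i j with rfl | h
    · rw [Pi.single_eq_same]
    · rw [Pi.single_eq_of_ne h, norm_zero]
      exact norm_nonneg _

theorem ofFun_apply (g : Lp ℂ ∞ μ) (ψ : H.besov s) : H.ofFun s g ψ = pairing μ ψ g := rfl

/-- The functional with coefficient `1` at one index and `0` at the others; the index `none`
belongs to the constant function. -/
def HaarSystem.unitFunctional (H : HaarSystem G) (s : ℝ) : Option H.Idx → H.Functional s
  | none => H.ofFun s (oneFun μ)
  | some i => ((μ.real i.2.1.1 ^ (-s) : ℝ) : ℂ) • H.ofFun s (H.wavelet i)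

theorem unitFunctional_apply_some {ψ : H.besov s} {cI : ℂ} {c : H.Idx → ℂ}
    (h : H.IsFunSeries s ψ.1 cI c) (i : H.Idx) : H.unitFunctional s (some i) ψ =
      ((μ.real i.2.1.1 * H.waveletSq i : ℝ) : ℂ) * c i := by
  have hpos := cell_measure_pos i.2.1
  rw [HaarSystem.unitFunctional, LinearMap.smul_apply, ofFun_apply,
    pairing_wavelet_of_isFunSeries h, smul_eq_mul, Real.rpow_add hpos, Real.rpow_one,
    Real.rpow_neg hpos.le]
  have : ((μ.real i.2.1.1 ^ s : ℝ) : ℂ) ≠ 0 := by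
    exact_mod_cast (Real.rpow_pos_of_pos hpos s).ne'
  push_cast
  field_simp

theorem norm_unitFunctional_some_le {ψ : H.besov s} {cI : ℂ} {c : H.Idx → ℂ}
    (h : H.IsFunSeries s ψ.1 cI c) (i : H.Idx) :
    ‖H.unitFunctional s (some i) ψ‖ ≤ G.unitBound * ‖c i‖ := by
  rw [unitFunctional_apply_some h, norm_mul, Complex.norm_real, Real.norm_of_nonneg
    (mul_nonneg (cell_measure_pos _).le (waveletSq_pos i).le)]
  refine mul_le_mul_of_nonneg_right ((measure_mul_waveletSq_le i).trans ?_) (norm_nonneg _)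
  rw [GoodGrid.unitBound]
  linarith

theorem enorm_unitFunctional_le (ψ : H.besov s) (o : Option H.Idx) :
    ‖H.unitFunctional s o ψ‖ₑ ≤ ENNReal.ofReal G.unitBound * H.besovNorm s ψ := by
  -- A nonzero finite constant can be moved inside the infimum, so that each expansion of `ψ` is
  -- treated separately.
  simp only [HaarSystem.besovNorm, ENNReal.mul_iInf_of_ne
    (ENNReal.ofReal_pos.2 (one_pos.trans_le one_le_unitBound)).ne' ENNReal.ofReal_ne_top]
  refine le_iInf fun cI => le_iInf fun c => le_iInf fun h => ?_
  cases o with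
  | none =>
    rw [HaarSystem.unitFunctional, ofFun_apply, pairing_oneFun_of_isFunSeries h]
    calc ‖cI‖ₑ ≤ 1 * (‖cI‖ₑ + ⨆ i, ‖c i‖ₑ) := by rw [one_mul]; exact le_self_add
      _ ≤ _ := by
        gcongr
        rw [← ENNReal.ofReal_one]
        exact ENNReal.ofReal_le_ofReal one_le_unitBound
  | some i =>
    calc ‖H.unitFunctional s (some i) ψ‖ₑ ≤ ENNReal.ofReal G.unitBound * ‖c i‖ₑ := by
          rw [← ofReal_norm, ← ofReal_norm, ← ENNReal.ofReal_mul
            (zero_le_one.trans one_le_unitBound)]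
          exact ENNReal.ofReal_le_ofReal (norm_unitFunctional_some_le h i)
      _ ≤ _ := by
        gcongr
        exact (le_iSup (fun i => ‖c i‖ₑ) i).trans le_add_self

theorem exists_norm_unitFunctional_le (ψ : H.besov s) :
    ∃ M : ℝ, ∀ o, ‖H.unitFunctional s o ψ‖ ≤ M := by
  obtain ⟨cI, c, h, M, hM⟩ := ψ.2
  refine ⟨max ‖cI‖ (G.unitBound * M), fun o => ?_⟩
  cases o with
  | none =>
    rw [HaarSystem.unitFunctional, ofFun_apply, pairing_oneFun_of_isFunSeries h]
    exact le_max_left _ _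
  | some i =>
    refine (norm_unitFunctional_some_le h i).trans (le_trans ?_ (le_max_right _ _))
    exact mul_le_mul_of_nonneg_left (hM i) (zero_le_one.trans one_le_unitBound)

theorem summable_coeff_mul (a : H.Coeff) (ψ : H.besov s) :
    Summable fun o => a o * H.unitFunctional s o ψ := by
  obtain ⟨M, hM⟩ := exists_norm_unitFunctional_le ψ
  refine Summable.of_norm_bounded ((summable_norm_coeff a).mul_right M) fun o => ?_
  rw [norm_mul]
  exact mul_le_mul_of_nonneg_left (hM o) (norm_nonneg _)

/-- The functional with given coefficients. -/
def HaarSystem.synth (H : HaarSystem G) (s : ℝ) : H.Coeff →ₗ[ℂ] H.Functional s :=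
  LinearMap.mk₂ ℂ (fun a ψ => ∑' o, a o * H.unitFunctional s o ψ)
    (fun a b ψ => by
      rw [← (summable_coeff_mul a ψ).tsum_add (summable_coeff_mul b ψ)]
      simp only [lp.coeFn_add, Pi.add_apply, add_mul])
    (fun t a ψ => by
      rw [smul_eq_mul, ← tsum_mul_left]
      simp only [lp.coeFn_smul, Pi.smul_apply, smul_eq_mul, mul_assoc])
    (fun a ψ ψ' => by
      rw [← (summable_coeff_mul a ψ).tsum_add (summable_coeff_mul a ψ')]
      simp only [map_add, mul_add])
    fun t a ψ => by
      rw [smul_eq_mul, ← tsum_mul_left]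
      simp only [map_smul, smul_eq_mul, mul_left_comm]

theorem hasSum_synth (a : H.Coeff) (ψ : H.besov s) :
    HasSum (fun o => a o * H.unitFunctional s o ψ) (H.synth s a ψ) :=
  (summable_coeff_mul a ψ).hasSum

theorem isDistSeries_iff {φ : H.Functional s} {dI : ℂ} {d : H.Idx → ℂ} :
    H.IsDistSeries s φ dI d ↔ ∀ ψ : H.besov s, Tendsto (fun N => ∑ o ∈ Finset.insertNone (H.box N),
      o.elim dI d * H.unitFunctional s o ψ) atTop (𝓝 (φ ψ)) := by
  refine forall_congr' fun ψ => ?_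
  simp only [Finset.sum_insertNone, ← sum_box, mul_assoc]
  rfl

theorem synth_isDistSeries (a : H.Coeff) :
    H.IsDistSeries s (H.synth s a) (a none) fun i => a (some i) := by
  refine isDistSeries_iff.2 fun ψ => ?_
  refine ((hasSum_synth a ψ).comp tendsto_insertNone_box).congr fun N => ?_
  refine Finset.sum_congr rfl fun o _ => ?_
  cases o <;> rfl

theorem exists_synth_eq {φ : H.Functional s} {dI : ℂ} {d : H.Idx → ℂ}
    (h : H.IsDistSeries s φ dI d) (hd : Summable fun i => ‖d i‖) :
    ∃ a : H.Coeff, H.synth s a = φ ∧ a none = dI ∧ ∀ i, a (some i) = d i := by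
  have hmem : Memℓp (fun o : Option H.Idx => o.elim dI d) 1 := by
    refine memℓp_gen ?_
    simpa using (hasSum_option (f := fun o : Option H.Idx => ‖(o.elim dI d : ℂ)‖)
      hd.hasSum).summable
  refine ⟨⟨_, hmem⟩, LinearMap.ext fun ψ => ?_, rfl, fun i => rfl⟩
  exact tendsto_nhds_unique ((hasSum_synth ⟨_, hmem⟩ ψ).comp tendsto_insertNone_box)
    (isDistSeries_iff.1 h ψ)

theorem synth_apply_oneFun (a : H.Coeff) :
    H.synth s a ⟨oneFun μ, oneFun_mem_besov⟩ = a none := by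
  refine (hasSum_synth a _).unique ?_
  convert hasSum_single none (fun o ho => ?_) using 1
  · rw [HaarSystem.unitFunctional, ofFun_apply, pairing_oneFun_self, mul_one]
  · cases o with
    | none => exact absurd rfl ho
    | some i => rw [HaarSystem.unitFunctional, LinearMap.smul_apply, ofFun_apply,
        pairing_oneFun_haar, smul_zero, mul_zero]

theorem synth_apply_wavelet (a : H.Coeff) (j : H.Idx) :
    H.synth s a ⟨H.wavelet j, wavelet_mem_besov j⟩ =
      a (some j) * (((μ.real j.2.1.1 ^ (-s) : ℝ) : ℂ) * ((H.waveletSq j : ℝ) : ℂ)) := by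
  refine (hasSum_synth a _).unique ?_
  convert hasSum_single (some j) (fun o ho => ?_) using 1
  · rw [HaarSystem.unitFunctional, LinearMap.smul_apply, ofFun_apply, pairing_wavelet_self,
      smul_eq_mul]
  · cases o with
    | none => rw [HaarSystem.unitFunctional, ofFun_apply, pairing_comm, pairing_oneFun_haar,
        mul_zero]
    | some i =>
      have hij : j ≠ i := fun h => ho (congrArg some h.symm)
      rw [HaarSystem.unitFunctional, LinearMap.smul_apply, ofFun_apply,
        pairing_wavelet_of_ne hij, smul_zero, mul_zero]

/-- Testing on `1` and on the wavelets returns each coefficient times a nonzero number. -/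
theorem synth_injective : Function.Injective (H.synth s) := by
  rw [← LinearMap.ker_eq_bot, LinearMap.ker_eq_bot']
  intro a ha
  refine lp.ext (funext fun o => ?_)
  cases o with
  | none =>
    rw [← synth_apply_oneFun (s := s) a, ha]
    rfl
  | some j =>
    have h := synth_apply_wavelet (s := s) a j
    rw [ha, LinearMap.zero_apply, eq_comm, mul_eq_zero] at h
    refine h.resolve_right ?_
    have h1 := Real.rpow_pos_of_pos (cell_measure_pos j.2.1) (-s)
    have h2 := waveletSq_pos j
    exact_mod_cast (mul_pos h1 h2).ne'

theorem enorm_synth_le (a : H.Coeff) (ψ : H.besov s) :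
    ‖H.synth s a ψ‖ₑ ≤ ENNReal.ofReal (‖a‖ * G.unitBound) * H.besovNorm s ψ := by
  calc ‖H.synth s a ψ‖ₑ ≤ ∑' o, ‖a o * H.unitFunctional s o ψ‖ₑ := enorm_tsum_le_tsum_enorm
    _ ≤ ∑' o, ‖a o‖ₑ * (ENNReal.ofReal G.unitBound * H.besovNorm s ψ) := by
        refine ENNReal.tsum_le_tsum fun o => ?_
        rw [enorm_mul]
        gcongr
        exact enorm_unitFunctional_le ψ o
    _ = _ := by
        rw [ENNReal.tsum_mul_right, ← enorm_coeff, ENNReal.ofReal_mul (norm_nonneg _),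
          ofReal_norm, mul_assoc]

/-- The continuity required of a member is automatic for summable coefficients, by `enorm_synth_le`.
-/
theorem mem_negBesov_iff {φ : H.Functional s} : φ ∈ H.negBesov s ↔ ∃ a, H.synth s a = φ := by
  constructor
  · rintro ⟨-, dI, d, h, hd⟩
    obtain ⟨a, ha, -⟩ := exists_synth_eq h hd
    exact ⟨a, ha⟩
  · rintro ⟨a, rfl⟩
    refine ⟨⟨_, enorm_synth_le a⟩, _, _, synth_isDistSeries a, ?_⟩
    exact (summable_norm_coeff a).comp_injective (Option.some_injective _)

/-- Expansions that are not summable cost `∞`, and by injectivity only one is summable. -/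
theorem negNorm_synth (a : H.Coeff) : H.negNorm s (H.synth s a) = ‖a‖ₑ := by
  rw [enorm_coeff_eq]
  refine le_antisymm (iInf_le_of_le _ (iInf_le_of_le _ (iInf_le _ (synth_isDistSeries a)))) ?_
  refine le_iInf fun dI => le_iInf fun d => le_iInf fun h => ?_
  by_cases hd : ∑' i, ‖d i‖ₑ = ∞
  · rw [hd, add_top]
    exact le_top
  · have hd' : Summable fun i => ‖d i‖ := by
      simpa [toReal_enorm] using ENNReal.summable_toReal hd
    obtain ⟨b, hb, h1, h2⟩ := exists_synth_eq h hd'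
    obtain rfl := synth_injective hb
    simp only [h1, h2, le_refl]

theorem negTendsto_synth_iff {u : ℕ → H.Coeff} {a : H.Coeff} :
    H.NegTendsto s (fun n => H.synth s (u n)) (H.synth s a) ↔ Tendsto u atTop (𝓝 a) := by
  rw [HaarSystem.NegTendsto, and_iff_right (mem_negBesov_iff.2 ⟨a, rfl⟩),
    tendsto_iff_edist_tendsto_0]
  simp only [← map_sub, negNorm_synth, edist_eq_enorm_sub]

end

/-! ### Atomic norms in a normed space -/

section Atomic

variable {X : Type*} [NormedAddCommGroup X]

theorem summable_norm_of_tsum_enorm {ι : Type*} {f : ι → X} (h : ∑' i, ‖f i‖ₑ ≠ ∞) :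
    Summable fun i => ‖f i‖ := by
  simpa [toReal_enorm] using ENNReal.summable_toReal h

theorem enorm_le_tsum_of_tendsto {f : ℕ → X} {a : X}
    (h : Tendsto (fun N => ∑ i ∈ Finset.range N, f i) atTop (𝓝 a)) : ‖a‖ₑ ≤ ∑' i, ‖f i‖ₑ :=
  le_of_tendsto h.enorm (Eventually.of_forall fun _ =>
    (enorm_sum_le _ _).trans (ENNReal.sum_le_tsum _))

/-- Absolute summability of the double family allows it to be enumerated as one sequence; this is
how countably many representations are merged. -/
theorem tendsto_sum_unpair [CompleteSpace X] {f : ℕ → ℕ → X} {g : ℕ → X}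
    (hf : ∑' n, ∑' i, ‖f n i‖ₑ ≠ ∞)
    (hg : ∀ n, Tendsto (fun N => ∑ i ∈ Finset.range N, f n i) atTop (𝓝 (g n))) :
    Summable g ∧ Tendsto (fun N => ∑ m ∈ Finset.range N, f m.unpair.1 m.unpair.2) atTop
      (𝓝 (∑' n, g n)) := by
  have h0 : ∑' p : ℕ × ℕ, ‖f p.1 p.2‖ₑ ≠ ∞ :=
    (ENNReal.tsum_prod (f := fun n i => ‖f n i‖ₑ)).trans_ne hf
  have h1 : Summable fun p : ℕ × ℕ => f p.1 p.2 :=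
    Summable.of_norm (summable_norm_of_tsum_enorm h0)
  have h2 : ∀ n, HasSum (f n) (g n) := fun n =>
    ((h1.prod_factor n).hasSum_iff_tendsto_nat).2 (hg n)
  have h3 := h1.hasSum.prod_fiberwise h2
  refine ⟨h3.summable, ?_⟩
  rw [h3.tsum_eq]
  exact ((Nat.pairEquiv.symm.hasSum_iff (f := fun p : ℕ × ℕ => f p.1 p.2)).2
    h1.hasSum).tendsto_sum_nat

theorem tsum_unpair (f : ℕ → ℕ → ℝ≥0∞) :
    ∑' m : ℕ, f m.unpair.1 m.unpair.2 = ∑' n, ∑' i, f n i := by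
  rw [← ENNReal.tsum_prod]
  exact Nat.pairEquiv.symm.tsum_eq fun p : ℕ × ℕ => f p.1 p.2

variable [NormedSpace ℂ X] {Z : Type*}

/-- `a = ∑ c_i δ(z_i) + ∑ b_j (δ(y_j) - δ(x_j))`. -/
def IsAtomicRep (δ : Z → X) (a : X) (c : ℕ → ℂ) (z : ℕ → Z) (b : ℕ → ℂ) (x y : ℕ → Z) : Prop :=
  ∃ a₁ a₂ : X, a = a₁ + a₂ ∧
    Tendsto (fun N => ∑ i ∈ Finset.range N, c i • δ (z i)) atTop (𝓝 a₁) ∧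
    Tendsto (fun N => ∑ j ∈ Finset.range N, b j • (δ (y j) - δ (x j))) atTop (𝓝 a₂)

/-- The infimum of the costs `∑ |c_i| + ∑ |b_j| w(x_j, y_j)` over all representations
`a = ∑ c_i δ(z_i) + ∑ b_j (δ(y_j) - δ(x_j))`. -/
def atomicNorm (δ : Z → X) (w : Z → Z → ℝ≥0∞) (a : X) : ℝ≥0∞ :=
  ⨅ (c : ℕ → ℂ) (z : ℕ → Z) (b : ℕ → ℂ) (x : ℕ → Z) (y : ℕ → Z)
    (_ : IsAtomicRep δ a c z b x y), ∑' i, ‖c i‖ₑ + ∑' j, ‖b j‖ₑ * w (x j) (y j)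

variable {δ : Z → X} {w : Z → Z → ℝ≥0∞}

theorem atomicNorm_le {a : X} {c : ℕ → ℂ} {z : ℕ → Z} {b : ℕ → ℂ} {x y : ℕ → Z}
    (h : IsAtomicRep δ a c z b x y) :
    atomicNorm δ w a ≤ ∑' i, ‖c i‖ₑ + ∑' j, ‖b j‖ₑ * w (x j) (y j) :=
  iInf_le_of_le c <| iInf_le_of_le z <| iInf_le_of_le b <| iInf_le_of_le x <|
    iInf_le_of_le y <| iInf_le _ h

theorem le_atomicNorm {a : X} {r : ℝ≥0∞}
    (h : ∀ c z b x y, IsAtomicRep δ a c z b x y →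
      r ≤ ∑' i, ‖c i‖ₑ + ∑' j, ‖b j‖ₑ * w (x j) (y j)) : r ≤ atomicNorm δ w a :=
  le_iInf fun c => le_iInf fun z => le_iInf fun b => le_iInf fun x => le_iInf fun y =>
    le_iInf fun hr => h c z b x y hr

theorem exists_lt_of_atomicNorm_lt {a : X} {r : ℝ≥0∞} (h : atomicNorm δ w a < r) :
    ∃ c z b x y, IsAtomicRep δ a c z b x y ∧
      ∑' i, ‖c i‖ₑ + ∑' j, ‖b j‖ₑ * w (x j) (y j) < r := by
  simpa only [atomicNorm, iInf_lt_iff, exists_prop] using h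

theorem atomicNorm_zero [Nonempty Z] : atomicNorm δ w 0 = 0 := by
  obtain ⟨z⟩ := ‹Nonempty Z›
  refine le_antisymm ((atomicNorm_le (c := 0) (z := fun _ => z) (b := 0) (x := fun _ => z)
    (y := fun _ => z) ⟨0, 0, by simp, by simp, by simp⟩).trans_eq (by simp)) zero_le

theorem atomicNorm_smul_le [Nonempty Z] (t : ℂ) (a : X) :
    atomicNorm δ w (t • a) ≤ ‖t‖ₑ * atomicNorm δ w a := by
  rcases eq_or_ne t 0 with rfl | ht
  · rw [zero_smul, atomicNorm_zero]
    exact zero_le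
  · refine (ENNReal.div_le_iff' (by simpa using ht) enorm_ne_top).1 (le_atomicNorm ?_)
    rintro c z b x y ⟨a₁, a₂, rfl, h₁, h₂⟩
    refine (ENNReal.div_le_iff' (by simpa using ht) enorm_ne_top).2 ?_
    refine (atomicNorm_le (c := fun i => t * c i) (z := z) (b := fun j => t * b j) (x := x)
      (y := y) ⟨t • a₁, t • a₂, smul_add _ _ _, ?_, ?_⟩).trans_eq ?_
    · simpa only [mul_smul, Finset.smul_sum] using h₁.const_smul t
    · simpa only [mul_smul, Finset.smul_sum] using h₂.const_smul t
    · simp only [enorm_mul, mul_assoc, ENNReal.tsum_mul_left, mul_add]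

theorem atomicNorm_smul [Nonempty Z] (t : ℂ) (a : X) :
    atomicNorm δ w (t • a) = ‖t‖ₑ * atomicNorm δ w a := by
  refine le_antisymm (atomicNorm_smul_le t a) ?_
  rcases eq_or_ne t 0 with rfl | ht
  · simp
  · have h := atomicNorm_smul_le (δ := δ) (w := w) t⁻¹ (t • a)
    rw [inv_smul_smul₀ ht, enorm_inv ht, mul_comm, ← div_eq_mul_inv] at h
    -- The reverse inequality is the direct one for the scalar `t⁻¹` and the vector `t • a`.
    exact (ENNReal.le_div_iff_mul_le (Or.inl (by simpa using ht)) (Or.inl enorm_ne_top)).1 h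
      |>.trans_eq' (mul_comm _ _)

theorem atomicNorm_atom_le (z : Z) : atomicNorm δ w (δ z) ≤ 1 := by
  refine (atomicNorm_le (c := Pi.single 0 1) (z := fun _ => z) (b := 0) (x := fun _ => z)
    (y := fun _ => z) ⟨δ z, 0, by simp, tendsto_const_nhds.congr' ?_, by simp⟩).trans_eq ?_
  · filter_upwards [eventually_gt_atTop 0] with N hN
    rw [← Finset.sum_smul, Finset.sum_pi_single', if_pos (Finset.mem_range.2 hN), one_smul]
  · rw [tsum_eq_single 0 fun i hi => by rw [Pi.single_eq_of_ne hi, enorm_zero]]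
    simp

theorem atomicNorm_dipole_le (x y : Z) : atomicNorm δ w (δ y - δ x) ≤ w x y := by
  refine (atomicNorm_le (c := 0) (z := fun _ => x) (b := Pi.single 0 1) (x := fun _ => x)
    (y := fun _ => y) ⟨0, δ y - δ x, by simp, by simp,
      tendsto_const_nhds.congr' ?_⟩).trans_eq ?_
  · filter_upwards [eventually_gt_atTop 0] with N hN
    rw [← Finset.sum_smul, Finset.sum_pi_single', if_pos (Finset.mem_range.2 hN), one_smul]
  · rw [ENNReal.tsum_mul_right,
      tsum_eq_single (f := fun j => ‖(Pi.single 0 1 : ℕ → ℂ) j‖ₑ) 0 fun i hi => by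
        rw [Pi.single_eq_of_ne hi, enorm_zero]]
    simp

/-- Triangle inequality, term by term, in each representation. -/
theorem enorm_le_atomicNorm {K : ℝ≥0∞} (hK0 : K ≠ 0) (hK : K ≠ ∞) (hδ : ∀ z, ‖δ z‖ₑ ≤ K)
    (hw : ∀ x y, ‖δ y - δ x‖ₑ ≤ K * w x y) (a : X) : ‖a‖ₑ ≤ K * atomicNorm δ w a := by
  refine (ENNReal.div_le_iff' hK0 hK).1 (le_atomicNorm ?_)
  rintro c z b x y ⟨a₁, a₂, rfl, h₁, h₂⟩
  refine (ENNReal.div_le_iff' hK0 hK).2 ((enorm_add_le _ _).trans ?_)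
  rw [mul_add, ← ENNReal.tsum_mul_left, ← ENNReal.tsum_mul_left]
  refine add_le_add ((enorm_le_tsum_of_tendsto h₁).trans (ENNReal.tsum_le_tsum fun i => ?_))
    ((enorm_le_tsum_of_tendsto h₂).trans (ENNReal.tsum_le_tsum fun j => ?_))
  · rw [enorm_smul, mul_comm]
    gcongr
    exact hδ _
  · rw [enorm_smul, mul_left_comm]
    gcongr
    exact hw _ _

variable [CompleteSpace X]

/-- Take for each `f n` a representation that is optimal up to `ε' n`, with these errors summing to
less than `ε`, and merge them all. The bounds by `K` turn finite total cost into absolute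
convergence, which justifies the merging. -/
theorem atomicNorm_le_tsum {K : ℝ≥0∞} (hK : K ≠ ∞) (hδ : ∀ z, ‖δ z‖ₑ ≤ K)
    (hw : ∀ x y, ‖δ y - δ x‖ₑ ≤ K * w x y) {f : ℕ → X} {a : X}
    (h : Tendsto (fun N => ∑ n ∈ Finset.range N, f n) atTop (𝓝 a)) :
    atomicNorm δ w a ≤ ∑' n, atomicNorm δ w (f n) := by
  refine ENNReal.le_of_forall_pos_le_add fun ε hε hfin => ?_
  obtain ⟨ε', hε', hsum⟩ := ENNReal.exists_pos_sum_of_countable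
    (ENNReal.coe_pos.2 hε).ne' ℕ
  have hlt : ∀ n, atomicNorm δ w (f n) < atomicNorm δ w (f n) + ε' n := fun n =>
    ENNReal.lt_add_right (ENNReal.ne_top_of_tsum_ne_top hfin.ne n)
      (ENNReal.coe_pos.2 (hε' n)).ne'
  choose c z b x y hrep hcost using fun n => exists_lt_of_atomicNorm_lt (hlt n)
  choose a₁ a₂ ha h₁ h₂ using hrep
  have htot : ∑' n, ∑' i, ‖c n i‖ₑ + ∑' n, ∑' j, ‖b n j‖ₑ * w (x n j) (y n j) ≤
      ∑' n, atomicNorm δ w (f n) + ε := by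
    rw [← ENNReal.tsum_add]
    refine (ENNReal.tsum_le_tsum fun n => (hcost n).le).trans ?_
    rw [ENNReal.tsum_add]
    gcongr
  have htop : ∑' n, atomicNorm δ w (f n) + ε < ∞ :=
    ENNReal.add_lt_top.2 ⟨hfin, ENNReal.coe_lt_top⟩
  obtain ⟨hc, hb⟩ := ENNReal.add_lt_top.1 (htot.trans_lt htop)
  obtain ⟨s₁, t₁⟩ := tendsto_sum_unpair (f := fun n i => c n i • δ (z n i)) (g := a₁)
    (ne_top_of_le_ne_top (ENNReal.mul_ne_top hK hc.ne) (by
      simp only [← ENNReal.tsum_mul_left]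
      refine ENNReal.tsum_le_tsum fun n => ENNReal.tsum_le_tsum fun i => ?_
      rw [enorm_smul, mul_comm]
      gcongr
      exact hδ _)) h₁
  obtain ⟨s₂, t₂⟩ := tendsto_sum_unpair (f := fun n j => b n j • (δ (y n j) - δ (x n j)))
    (g := a₂) (ne_top_of_le_ne_top (ENNReal.mul_ne_top hK hb.ne) (by
      simp only [← ENNReal.tsum_mul_left]
      refine ENNReal.tsum_le_tsum fun n => ENNReal.tsum_le_tsum fun i => ?_
      rw [enorm_smul, mul_left_comm]
      gcongr
      exact hw _ _)) h₂
  have hsum' : a = ∑' n, a₁ n + ∑' n, a₂ n := by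
    refine tendsto_nhds_unique h ?_
    simp only [ha]
    exact (s₁.hasSum.add s₂.hasSum).tendsto_sum_nat
  refine (atomicNorm_le ⟨_, _, hsum', t₁, t₂⟩).trans (le_trans (le_of_eq ?_) htot)
  rw [tsum_unpair fun n i => ‖c n i‖ₑ, tsum_unpair fun n j => ‖b n j‖ₑ * w (x n j) (y n j)]

theorem atomicNorm_add_le [Nonempty Z] {K : ℝ≥0∞} (hK : K ≠ ∞) (hδ : ∀ z, ‖δ z‖ₑ ≤ K)
    (hw : ∀ x y, ‖δ y - δ x‖ₑ ≤ K * w x y) (a a' : X) :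
    atomicNorm δ w (a + a') ≤ atomicNorm δ w a + atomicNorm δ w a' := by
  let f : ℕ → X := fun n => if n = 0 then a else if n = 1 then a' else 0
  have h0 : ∀ n ∉ Finset.range 2, f n = 0 := fun n hn => by
    rw [Finset.mem_range, not_lt] at hn
    simp only [f]
    rw [if_neg (by omega), if_neg (by omega)]
  have h : HasSum f (a + a') := by
    have : HasSum f (∑ n ∈ Finset.range 2, f n) := hasSum_sum_of_ne_finset_zero h0
    simpa [Finset.sum_range_succ, f] using this
  refine (atomicNorm_le_tsum hK hδ hw h.tendsto_sum_nat).trans_eq ?_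
  rw [tsum_eq_sum (s := Finset.range 2) fun n hn => by rw [h0 n hn, atomicNorm_zero]]
  simp [Finset.sum_range_succ, f]

theorem atomicNorm_sum_le [Nonempty Z] {K : ℝ≥0∞} (hK : K ≠ ∞) (hδ : ∀ z, ‖δ z‖ₑ ≤ K)
    (hw : ∀ x y, ‖δ y - δ x‖ₑ ≤ K * w x y) {ι : Type*} (s : Finset ι) (f : ι → X) :
    atomicNorm δ w (∑ i ∈ s, f i) ≤ ∑ i ∈ s, atomicNorm δ w (f i) :=
  Finset.le_sum_of_subadditive _ atomicNorm_zero.le (atomicNorm_add_le hK hδ hw) s f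

/-- If every vector can be approximated up to half of its norm at a cost comparable to its norm,
then the atomic norm is dominated by the norm. -/
theorem atomicNorm_le_of_approx [Nonempty Z] {K : ℝ≥0∞} (hK : K ≠ ∞) (hδ : ∀ z, ‖δ z‖ₑ ≤ K)
    (hw : ∀ x y, ‖δ y - δ x‖ₑ ≤ K * w x y) {M : ℝ≥0∞}
    (h : ∀ a : X, ∃ u, atomicNorm δ w u ≤ M * ‖a‖ₑ ∧ ‖a - u‖ₑ ≤ 2⁻¹ * ‖a‖ₑ) (a : X) :
    atomicNorm δ w a ≤ M * 2 * ‖a‖ₑ := by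
  choose u hu hau using h
  -- The successive remainders: each is at most half as large as the one before, and the sum of the
  -- approximants telescopes to `a - r N`.
  let r : ℕ → X := fun n => (fun v => v - u v)^[n] a
  have hr : ∀ n, r (n + 1) = r n - u (r n) := fun n => Function.iterate_succ_apply' _ _ _
  have hnorm : ∀ n, ‖r n‖ₑ ≤ 2⁻¹ ^ n * ‖a‖ₑ := by
    intro n
    induction n with
    | zero => simp [r]
    | succ n ih =>
      rw [hr, pow_succ', mul_assoc]
      exact (hau _).trans (by gcongr)
  have hsum : ∀ N, ∑ n ∈ Finset.range N, u (r n) = a - r N := by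
    intro N
    induction N with
    | zero => simp [r]
    | succ N ih => rw [Finset.sum_range_succ, ih, hr]; abel
  have hlim : Tendsto (fun N => ∑ n ∈ Finset.range N, u (r n)) atTop (𝓝 a) := by
    have h0 : Tendsto r atTop (𝓝 0) := by
      rw [tendsto_zero_iff_enorm_tendsto_zero]
      refine tendsto_of_tendsto_of_tendsto_of_le_of_le tendsto_const_nhds ?_
        (fun _ => zero_le) hnorm
      have := ENNReal.Tendsto.mul_const (b := ‖a‖ₑ) (ENNReal.tendsto_pow_atTop_nhds_zero_of_lt_one
        (r := 2⁻¹) (by simp)) (Or.inr enorm_ne_top)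
      simpa using this
    simp only [hsum]
    simpa using h0.const_sub a
  refine (atomicNorm_le_tsum hK hδ hw hlim).trans ?_
  calc ∑' n, atomicNorm δ w (u (r n)) ≤ ∑' n, M * (2⁻¹ ^ n * ‖a‖ₑ) :=
        ENNReal.tsum_le_tsum fun n => (hu _).trans (by gcongr; exact hnorm n)
    _ = M * 2 * ‖a‖ₑ := by
        rw [ENNReal.tsum_mul_left, ENNReal.tsum_mul_right, ENNReal.tsum_geometric,
          ENNReal.one_sub_inv_two, inv_inv, mul_assoc]

end Atomic

/-! ### Dirac masses in the `ℓ¹` model -/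

section

variable {Ω : Type*} [MeasurableSpace Ω] {μ : Measure Ω} {G : GoodGrid μ}
  {H : HaarSystem G} {s : ℝ}

open Classical in
/-- The unit vector of coefficients with index `o`. -/
def HaarSystem.unitCoeff (H : HaarSystem G) (o : Option H.Idx) : H.Coeff := lp.single 1 o 1

theorem norm_unitCoeff (o : Option H.Idx) : ‖H.unitCoeff o‖ = 1 := by
  classical
  rw [HaarSystem.unitCoeff, lp.norm_single one_pos, norm_one]

theorem mass_append {k : ℕ} (S T : List (G.Cell k)) : mass (S ++ T) = mass S + mass T := by
  simp [mass]

/-- The decay rate of the coefficients of Dirac masses. -/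
def GoodGrid.decay (G : GoodGrid μ) (s : ℝ) : ℝ := G.ratioUp ^ s

/-- The constant in the estimates of the distance of a Dirac mass to its approximants. -/
def GoodGrid.diracBound (G : GoodGrid μ) (s : ℝ) : ℝ := G.ratioLow⁻¹ / (1 - G.decay s)

theorem decay_pos : 0 < G.decay s := Real.rpow_pos_of_pos G.ratioUp_pos s

theorem decay_lt_one (hs : 0 < s) : G.decay s < 1 :=
  Real.rpow_lt_one G.ratioUp_pos.le G.ratioUp_lt_one hs

theorem diracBound_nonneg (hs : 0 < s) : 0 ≤ G.diracBound s :=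
  div_nonneg (inv_nonneg.2 G.ratioLow_pos.le) (sub_nonneg.2 (decay_lt_one hs).le)

variable [IsProbabilityMeasure μ]

/-- `HaarSystem.ofFun` as a linear map. -/
def HaarSystem.ofFunₗ (H : HaarSystem G) (s : ℝ) : Lp ℂ ∞ μ →ₗ[ℂ] H.Functional s where
  toFun := H.ofFun s
  map_add' g g' := LinearMap.ext fun ψ => by simp [ofFun_apply]
  map_smul' t g := LinearMap.ext fun ψ => by simp [ofFun_apply]

theorem synth_unitCoeff (o : Option H.Idx) :
    H.synth s (H.unitCoeff o) = H.unitFunctional s o := by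
  classical
  refine LinearMap.ext fun ψ => (hasSum_synth _ ψ).unique ?_
  convert hasSum_single o (fun o' ho => ?_) using 1
  · rw [HaarSystem.unitCoeff, lp.single_apply_self, one_mul]
  · rw [HaarSystem.unitCoeff, lp.single_apply_ne _ _ _ ho, zero_mul]

theorem synth_smul_unitCoeff_some (i : H.Idx) :
    H.synth s (((μ.real i.2.1.1 ^ s : ℝ) : ℂ) • H.unitCoeff (some i)) =
      H.ofFunₗ s (H.wavelet i) := by
  rw [map_smul, synth_unitCoeff, HaarSystem.unitFunctional, smul_smul, ← Complex.ofReal_mul,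
    ← Real.rpow_add (cell_measure_pos _), add_neg_cancel, Real.rpow_zero, Complex.ofReal_one,
    one_smul]
  rfl

theorem mass_smul_blockFun {k : ℕ} {S : List (G.Cell k)} (hS : S ≠ []) :
    ((mass S : ℝ) : ℂ) • blockFun G S = (S.map fun P => cellFun G P).sum := by
  rw [blockFun_eq, smul_smul, mul_inv_cancel₀, one_smul]
  exact_mod_cast (mass_pos hS).ne'

theorem blockFun_append {k : ℕ} {S T : List (G.Cell k)} (hS : S ≠ []) (hT : T ≠ []) :
    blockFun G (S ++ T) = ((mass S + mass T : ℝ) : ℂ)⁻¹ •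
      (((mass S : ℝ) : ℂ) • blockFun G S + ((mass T : ℝ) : ℂ) • blockFun G T) := by
  rw [mass_smul_blockFun hS, mass_smul_blockFun hT, blockFun_eq, mass_append, List.map_append,
    List.sum_append]

/-- The average over `S ++ T` is a convex combination of the averages over `S` and `T`, so its
difference with either is a multiple of their difference, by a factor of modulus at most one. -/
theorem exists_mul_haar {k : ℕ} {S T : List (G.Cell k)} (hS : S ≠ []) (hT : T ≠ []) :
    (∃ t : ℂ, ‖t‖ ≤ 1 ∧ blockFun G S - blockFun G (S ++ T) = t • haar G (S, T)) ∧
    ∃ t : ℂ, ‖t‖ ≤ 1 ∧ blockFun G T - blockFun G (S ++ T) = t • haar G (S, T) := by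
  have h1 := mass_pos hS
  have h2 := mass_pos hT
  have h3 : ((mass S : ℝ) : ℂ) + ((mass T : ℝ) : ℂ) ≠ 0 := by exact_mod_cast (add_pos h1 h2).ne'
  refine ⟨⟨((mass T / (mass S + mass T) : ℝ) : ℂ), ?_, ?_⟩,
    ⟨((-(mass S / (mass S + mass T)) : ℝ) : ℂ), ?_, ?_⟩⟩
  · rw [Complex.norm_real, Real.norm_of_nonneg (by positivity)]
    exact div_le_one_of_le₀ (by linarith) (by positivity)
  · rw [blockFun_append hS hT, haar]
    push_cast
    match_scalars <;> field_simp <;> ring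
  · rw [Complex.norm_real, norm_neg, Real.norm_of_nonneg (by positivity)]
    exact div_le_one_of_le₀ (by linarith) (by positivity)
  · rw [blockFun_append hS hT, haar]
    push_cast
    match_scalars <;> field_simp <;> ring

/-- Halve `l` repeatedly, keeping the half that contains `R`. Every halving contributes one wavelet
with normalised coefficient at most `|Q|^s`, and since the discarded half is never empty there are
at most `l.length` of them. -/
theorem exists_synth_blockFun_sub {k : ℕ} (Q : G.Cell k) (l : List (G.Cell (k + 1)))
    (hl : haarPairs l ⊆ haarPairs (H.order k Q)) {R : G.Cell (k + 1)} (hR : R ∈ l) :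
    ∃ v : H.Coeff, H.synth s v = H.ofFunₗ s (blockFun G [R] - blockFun G l) ∧
      ‖v‖ ≤ μ.real Q.1 ^ s * l.length := by
  induction l using halving_induction with
  | h l ih =>
    by_cases h2 : 2 ≤ l.length
    · obtain ⟨ih1, ih2⟩ := ih h2
      have hp : (l.take (l.length / 2), l.drop (l.length / 2)) ∈ haarPairs (H.order k Q) :=
        hl (mem_haarPairs.2 ⟨h2, Or.inl rfl⟩)
      have hne := haarPairs_ne_nil hp
      have happ := List.take_append_drop (l.length / 2) l
      have hlen := congrArg List.length happ
      rw [List.length_append] at hlen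
      have hlen' : ((l.take (l.length / 2)).length : ℝ) + (l.drop (l.length / 2)).length =
        l.length := by exact_mod_cast hlen
      have hp1 : (1 : ℝ) ≤ (l.take (l.length / 2)).length := by
        exact_mod_cast List.length_pos_iff_ne_nil.2 hne.1
      have hp2 : (1 : ℝ) ≤ (l.drop (l.length / 2)).length := by
        exact_mod_cast List.length_pos_iff_ne_nil.2 hne.2
      have hQ := Real.rpow_nonneg (cell_measure_pos Q).le s
      obtain ⟨⟨t1, ht1, e1⟩, ⟨t2, ht2, e2⟩⟩ := exists_mul_haar hne.1 hne.2
      rw [happ] at e1 e2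
      have key : ∀ (U : List (G.Cell (k + 1))) (v : H.Coeff) (t : ℂ), ‖t‖ ≤ 1 →
          H.synth s v = H.ofFunₗ s (blockFun G [R] - blockFun G U) →
          blockFun G U - blockFun G l = t • haar G (l.take (l.length / 2), l.drop (l.length / 2)) →
          ‖v‖ ≤ μ.real Q.1 ^ s * U.length → (U.length : ℝ) + 1 ≤ l.length →
          ∃ v : H.Coeff, H.synth s v = H.ofFunₗ s (blockFun G [R] - blockFun G l) ∧
            ‖v‖ ≤ μ.real Q.1 ^ s * l.length := by
        intro U v t ht hv hU hnv hUl
        have hw : H.synth s (((μ.real Q.1 ^ s : ℝ) : ℂ) • H.unitCoeff (some ⟨k, Q, _, hp⟩)) =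
          H.ofFunₗ s (haar G (l.take (l.length / 2), l.drop (l.length / 2))) :=
            synth_smul_unitCoeff_some (s := s) ⟨k, Q, _, hp⟩
        refine ⟨v + t • (((μ.real Q.1 ^ s : ℝ) : ℂ) • H.unitCoeff (some ⟨k, Q, _, hp⟩)), ?_, ?_⟩
        · rw [map_add, map_smul, hw, hv, ← map_smul, ← hU, ← map_add, sub_add_sub_cancel]
        · have h1 := norm_add_le v
            (t • (((μ.real Q.1 ^ s : ℝ) : ℂ) • H.unitCoeff (some ⟨k, Q, _, hp⟩)))
          rw [norm_smul, norm_smul, norm_unitCoeff, Complex.norm_real, Real.norm_of_nonneg hQ]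
            at h1
          nlinarith [mul_le_mul_of_nonneg_right ht hQ, mul_le_mul_of_nonneg_left hUl hQ]
      have hR' : R ∈ l.take (l.length / 2) ∨ R ∈ l.drop (l.length / 2) := by
        rwa [← List.mem_append, happ]
      rcases hR' with hR' | hR'
      · obtain ⟨v, hv, hnv⟩ := ih1 (fun p hp => hl (mem_haarPairs.2 ⟨h2, Or.inr (Or.inl hp)⟩)) hR'
        exact key _ v t1 ht1 hv e1 hnv (by linarith)
      · obtain ⟨v, hv, hnv⟩ := ih2 (fun p hp => hl (mem_haarPairs.2 ⟨h2, Or.inr (Or.inr hp)⟩)) hR'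
        exact key _ v t2 ht2 hv e2 hnv (by linarith)
    · have h1 : l = [R] := by
        match l, hR, h2 with
        | [a], hR, _ => rw [List.mem_singleton.1 hR]
        | a :: b :: l, _, h2 => simp at h2
      refine ⟨0, by rw [h1, sub_self, map_zero, map_zero], ?_⟩
      rw [norm_zero]
      exact mul_nonneg (Real.rpow_nonneg measureReal_nonneg _) (Nat.cast_nonneg _)

theorem exists_synth_cellAvg_sub {k : ℕ} {Q : G.Cell k} {R : G.Cell (k + 1)} (h : R.1 ⊆ Q.1) :
    ∃ v : H.Coeff, H.synth s v = H.ofFunₗ s (cellAvg G R - cellAvg G Q) ∧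
      ‖v‖ ≤ G.ratioLow⁻¹ * μ.real Q.1 ^ s := by
  obtain ⟨v, hv, hn⟩ := exists_synth_blockFun_sub (H := H) (s := s) Q (H.order k Q) subset_rfl
    ((H.mem_order k Q R).2 h)
  rw [blockFun_order, blockFun_singleton] at hv
  refine ⟨v, hv, hn.trans ?_⟩
  rw [mul_comm]
  exact mul_le_mul_of_nonneg_right (length_order_le Q) (Real.rpow_nonneg measureReal_nonneg _)

theorem synth_unitCoeff_none :
    H.synth s (H.unitCoeff none) = H.ofFunₗ s (cellAvg G G.root) := by
  rw [synth_unitCoeff, HaarSystem.unitFunctional, cellAvg, ← oneFun_eq_cellFun, GoodGrid.root,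
    probReal_univ, Complex.ofReal_one, inv_one, one_smul]
  rfl

variable (H s) in
theorem exists_synth_cellAvg {k : ℕ} (Q : G.Cell k) :
    ∃ v : H.Coeff, H.synth s v = H.ofFunₗ s (cellAvg G Q) := by
  induction k with
  | zero => exact ⟨_, Subsingleton.elim G.root Q ▸ synth_unitCoeff_none⟩
  | succ k ih =>
    obtain ⟨P, hP⟩ := G.exists_parent Q
    obtain ⟨v, hv⟩ := ih P
    obtain ⟨v', hv', -⟩ := exists_synth_cellAvg_sub (H := H) (s := s) hP
    exact ⟨v + v', by rw [map_add, hv, hv', ← map_add, add_sub_cancel]⟩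

/-- The coefficients of `1_Q / |Q|`. -/
def HaarSystem.avgCoeff (H : HaarSystem G) (s : ℝ) {k : ℕ} (Q : G.Cell k) : H.Coeff :=
  (exists_synth_cellAvg H s Q).choose

theorem synth_avgCoeff {k : ℕ} (Q : G.Cell k) :
    H.synth s (H.avgCoeff s Q) = H.ofFunₗ s (cellAvg G Q) :=
  (exists_synth_cellAvg H s Q).choose_spec

theorem avgCoeff_root : H.avgCoeff s G.root = H.unitCoeff none :=
  synth_injective ((synth_avgCoeff _).trans synth_unitCoeff_none.symm)

theorem norm_avgCoeff_sub_le {k : ℕ} {Q : G.Cell k} {R : G.Cell (k + 1)} (h : R.1 ⊆ Q.1) :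
    ‖H.avgCoeff s R - H.avgCoeff s Q‖ ≤ G.ratioLow⁻¹ * μ.real Q.1 ^ s := by
  obtain ⟨v, hv, hn⟩ := exists_synth_cellAvg_sub (H := H) (s := s) h
  have : H.avgCoeff s R - H.avgCoeff s Q = v := synth_injective (s := s) <| by
    rw [map_sub, synth_avgCoeff, synth_avgCoeff, hv, map_sub]
  rwa [this]

theorem norm_avgCoeff_succ_sub_le (hs : 0 < s) (x : Point G) (k n : ℕ) :
    dist (H.avgCoeff s (x.cell (k + n))) (H.avgCoeff s (x.cell (k + (n + 1)))) ≤
      G.ratioLow⁻¹ * μ.real (x.cell k).1 ^ s * G.decay s ^ n := by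
  rw [dist_comm, dist_eq_norm]
  refine (norm_avgCoeff_sub_le (x.subset (k + n))).trans ?_
  rw [mul_assoc]
  refine mul_le_mul_of_nonneg_left ?_ (inv_nonneg.2 G.ratioLow_pos.le)
  refine (Real.rpow_le_rpow measureReal_nonneg (x.measure_cell_add_le k n) hs.le).trans_eq ?_
  rw [Real.mul_rpow (pow_nonneg G.ratioUp_pos.le _) measureReal_nonneg, GoodGrid.decay,
    ← Real.rpow_natCast, ← Real.rpow_natCast, ← Real.rpow_mul G.ratioUp_pos.le,
    ← Real.rpow_mul G.ratioUp_pos.le, mul_comm s, mul_comm]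

theorem exists_tendsto_avgCoeff (hs : 0 < s) (x : Point G) :
    ∃ v, Tendsto (fun j => H.avgCoeff s (x.cell j)) atTop (𝓝 v) := by
  obtain ⟨v, hv⟩ := cauchySeq_tendsto_of_complete (cauchySeq_of_le_geometric (G.decay s)
    (G.ratioLow⁻¹ * μ.real (x.cell 0).1 ^ s) (decay_lt_one hs)
    (norm_avgCoeff_succ_sub_le (H := H) hs x 0))
  exact ⟨v, hv.congr fun m => congrArg (fun j => H.avgCoeff s (x.cell j)) (zero_add m)⟩

/-- The coefficients of the Dirac mass at a point. -/
def HaarSystem.diracCoeff (H : HaarSystem G) (s : ℝ) (x : Point G) : H.Coeff :=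
  limUnder atTop fun j => H.avgCoeff s (x.cell j)

theorem tendsto_diracCoeff (hs : 0 < s) (x : Point G) :
    Tendsto (fun j => H.avgCoeff s (x.cell j)) atTop (𝓝 (H.diracCoeff s x)) :=
  tendsto_nhds_limUnder (exists_tendsto_avgCoeff hs x)

/-- A limit in `B^{-s}_{1,1}` lies in the range of `synth`, where limits are unique, so the
functional picked by the definition is this one. -/
theorem dirac_eq (hs : 0 < s) (x : Point G) : H.dirac s x = H.synth s (H.diracCoeff s x) := by
  have h : ∀ v : H.Coeff, H.NegTendsto s (fun j => H.ofFun s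
      (((μ.real (x.cell j).1 : ℝ) : ℂ)⁻¹ • cellFun G (x.cell j))) (H.synth s v) ↔
      v = H.diracCoeff s x := fun v => by
    have : (fun j => H.ofFun s (((μ.real (x.cell j).1 : ℝ) : ℂ)⁻¹ • cellFun G (x.cell j))) =
        fun j => H.synth s (H.avgCoeff s (x.cell j)) := funext fun j => (synth_avgCoeff _).symm
    rw [this, negTendsto_synth_iff]
    exact ⟨fun h => tendsto_nhds_unique h (tendsto_diracCoeff hs x),
      fun h => h ▸ tendsto_diracCoeff hs x⟩
  have hex := (⟨_, (h _).2 rfl⟩ : ∃ φ, H.NegTendsto s (fun j => H.ofFun s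
      (((μ.real (x.cell j).1 : ℝ) : ℂ)⁻¹ • cellFun G (x.cell j))) φ)
  rw [HaarSystem.dirac, dif_pos hex]
  obtain ⟨v, hv⟩ := mem_negBesov_iff.1 hex.choose_spec.1
  have h1 := hex.choose_spec
  rw [← hv, h] at h1
  rw [← hv, h1]

/-- Tail of a geometric series of ratio `decay`, starting at level `k`; this is where `diracBound`
comes from. -/
theorem norm_avgCoeff_sub_diracCoeff_le (hs : 0 < s) (x : Point G) (k : ℕ) :
    ‖H.avgCoeff s (x.cell k) - H.diracCoeff s x‖ ≤ G.diracBound s * μ.real (x.cell k).1 ^ s := by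
  have h := dist_le_of_le_geometric_of_tendsto₀ (G.decay s)
    (G.ratioLow⁻¹ * μ.real (x.cell k).1 ^ s) (decay_lt_one hs)
    (norm_avgCoeff_succ_sub_le (H := H) hs x k)
    ((tendsto_diracCoeff hs x).comp (tendsto_add_atTop_nat k |>.congr fun n => add_comm n k))
  rw [← dist_eq_norm]
  refine h.trans_eq ?_
  rw [GoodGrid.diracBound]
  ring

theorem norm_diracCoeff_le (hs : 0 < s) (x : Point G) :
    ‖H.diracCoeff s x‖ ≤ 1 + G.diracBound s := by
  have h := norm_avgCoeff_sub_diracCoeff_le (H := H) hs x 0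
  rw [Subsingleton.elim (x.cell 0) G.root, avgCoeff_root] at h
  have h1 : μ.real (G.root (μ := μ)).1 = 1 := probReal_univ
  rw [h1, Real.one_rpow, mul_one] at h
  have h2 := norm_sub_norm_le (H.diracCoeff s x) (H.unitCoeff none)
  rw [norm_unitCoeff, norm_sub_rev] at h2
  linarith

/-- Compare both Dirac masses with the average over the last common cell; hence the factor `2`. -/
theorem norm_diracCoeff_sub_le (hs : 0 < s) (x y : Point G) :
    ‖H.diracCoeff s y - H.diracCoeff s x‖ ≤ 2 * G.diracBound s * dHat x y ^ s := by
  rcases eq_or_exists_dHat_eq x y with rfl | ⟨n, hn, hd⟩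
  · rw [sub_self, norm_zero]
    have := diracBound_nonneg (G := G) hs
    have := Real.rpow_nonneg (dHat_nonneg x x) s
    positivity
  · have h1 := norm_avgCoeff_sub_diracCoeff_le (H := H) hs x n
    have h2 := norm_avgCoeff_sub_diracCoeff_le (H := H) hs y n
    rw [← hn] at h2
    rw [hd]
    have h3 := norm_sub_le (H.avgCoeff s (x.cell n) - H.diracCoeff s x)
      (H.avgCoeff s (x.cell n) - H.diracCoeff s y)
    rw [sub_sub_sub_cancel_left] at h3
    linarith

/-- Convergence of the two series includes membership of their sums in `B^{-s}_{1,1}`, so these sums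
lift to `ℓ¹`. -/
theorem isDiracDipoleRep_iff (hs : 0 < s) {a : H.Coeff} {c : ℕ → ℂ} {z : ℕ → Point G}
    {b : ℕ → ℂ} {x y : ℕ → Point G} : H.IsDiracDipoleRep s (H.synth s a) c z b x y ↔
      IsAtomicRep (H.diracCoeff s) a c z b x y := by
  simp only [HaarSystem.IsDiracDipoleRep, IsAtomicRep, dirac_eq hs, ← map_sub, ← map_smul,
    ← map_sum]
  constructor
  · rintro ⟨φ₁, φ₂, h, h₁, h₂⟩
    obtain ⟨a₁, rfl⟩ := mem_negBesov_iff.1 h₁.1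
    obtain ⟨a₂, rfl⟩ := mem_negBesov_iff.1 h₂.1
    rw [← map_add] at h
    exact ⟨a₁, a₂, synth_injective h, negTendsto_synth_iff.1 h₁, negTendsto_synth_iff.1 h₂⟩
  · rintro ⟨a₁, a₂, h, h₁, h₂⟩
    exact ⟨_, _, by rw [h, map_add], negTendsto_synth_iff.2 h₁, negTendsto_synth_iff.2 h₂⟩

theorem ddNormWith_synth (hs : 0 < s) (w : Point G → Point G → ℝ≥0∞) (a : H.Coeff) :
    H.ddNormWith s w (H.synth s a) = atomicNorm (H.diracCoeff s) w a := by
  simp only [HaarSystem.ddNormWith, atomicNorm, isDiracDipoleRep_iff hs]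

end

/-! ### Approximation by Dirac masses and dipoles -/

section

section Average

variable {Ω : Type*} [MeasurableSpace Ω] {μ : Measure Ω} {G : GoodGrid μ}
  {E : Type*} [AddCommGroup E] [Module ℂ E]

/-- The average of a function over the cells of a family, weighted by their measures. -/
def average {k : ℕ} (S : List (G.Cell k)) (F : G.Cell k → E) : E :=
  ((mass S : ℝ) : ℂ)⁻¹ • (S.map fun P => ((μ.real P.1 : ℝ) : ℂ) • F P).sum

theorem average_sub {k : ℕ} (S : List (G.Cell k)) (F F' : G.Cell k → E) :
    average S (fun P => F P - F' P) = average S F - average S F' := by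
  have h : (S.map fun P => ((μ.real P.1 : ℝ) : ℂ) • (F P - F' P)).sum =
      (S.map fun P => ((μ.real P.1 : ℝ) : ℂ) • F P).sum -
        (S.map fun P => ((μ.real P.1 : ℝ) : ℂ) • F' P).sum := by
    induction S with
    | nil => simp
    | cons P S ih =>
      rw [List.map_cons, List.sum_cons, ih, smul_sub, List.map_cons, List.sum_cons,
        List.map_cons, List.sum_cons]
      abel
  rw [average, h, smul_sub, average, average]

theorem map_average {E' : Type*} [AddCommGroup E'] [Module ℂ E'] (f : E →ₗ[ℂ] E') {k : ℕ}
    (S : List (G.Cell k)) (F : G.Cell k → E) :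
    f (average S F) = average S fun P => f (F P) := by
  simp only [average, map_smul, map_list_sum, List.map_map, Function.comp_def]

variable [IsProbabilityMeasure μ]

theorem average_const {k : ℕ} {S : List (G.Cell k)} (hS : S ≠ []) (a : E) :
    average S (fun _ => a) = a := by
  have h : (S.map fun P => ((μ.real P.1 : ℝ) : ℂ) • a).sum = ((mass S : ℝ) : ℂ) • a := by
    clear hS
    induction S with
    | nil => simp [mass]
    | cons P S ih =>
      rw [List.map_cons, List.sum_cons, ih, ← add_smul]
      simp [mass]
  rw [average, h, smul_smul, inv_mul_cancel₀, one_smul]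
  exact_mod_cast (mass_pos hS).ne'

/-- A subadditive homogeneous function of an average is at most its largest value. -/
theorem apply_average_le {q : E → ℝ≥0∞} (q_zero : q 0 = 0) (q_add : ∀ a b, q (a + b) ≤ q a + q b)
    (q_smul : ∀ (t : ℂ) a, q (t • a) ≤ ‖t‖ₑ * q a) {k : ℕ} {S : List (G.Cell k)} (hS : S ≠ [])
    {F : G.Cell k → E} {C : ℝ≥0∞} (h : ∀ P ∈ S, q (F P) ≤ C) : q (average S F) ≤ C := by
  have h1 : q (S.map fun P => ((μ.real P.1 : ℝ) : ℂ) • F P).sum ≤ ENNReal.ofReal (mass S) * C := by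
    clear hS
    induction S with
    | nil => simp [mass, q_zero]
    | cons P S ih =>
      have hS : 0 ≤ mass S := by
        rcases eq_or_ne S [] with rfl | hS
        · simp [mass]
        · exact (mass_pos hS).le
      have hm : mass (P :: S) = μ.real P.1 + mass S := by simp [mass]
      rw [List.map_cons, List.sum_cons, hm, ENNReal.ofReal_add measureReal_nonneg hS, add_mul]
      refine (q_add _ _).trans (add_le_add ((q_smul _ _).trans ?_)
        (ih fun R hR => h R (List.mem_cons_of_mem _ hR)))
      rw [← ofReal_norm, Complex.norm_real, Real.norm_of_nonneg measureReal_nonneg]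
      gcongr
      exact h P List.mem_cons_self
  have h0 := mass_pos hS
  calc q (average S F) ≤ ‖((mass S : ℝ) : ℂ)⁻¹‖ₑ * (ENNReal.ofReal (mass S) * C) :=
        (q_smul _ _).trans (by gcongr)
    _ = C := by
        rw [← mul_assoc, ← ofReal_norm, norm_inv, Complex.norm_real, Real.norm_of_nonneg h0.le,
          ← ENNReal.ofReal_mul (inv_nonneg.2 h0.le), inv_mul_cancel₀ h0.ne', ENNReal.ofReal_one,
          one_mul]

theorem blockFun_eq_average {k : ℕ} (S : List (G.Cell k)) :
    blockFun G S = average S fun P => cellAvg G P := by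
  rw [blockFun_eq, average]
  congr 3
  funext P
  rw [cellAvg, smul_smul, mul_inv_cancel₀, one_smul]
  exact_mod_cast (cell_measure_pos P).ne'

end Average

variable {Ω : Type*} [MeasurableSpace Ω] {μ : Measure Ω} {G : GoodGrid μ}
  {H : HaarSystem G} {s : ℝ}

/-- The bound for the cost of approximating `1_Q / |Q|`. -/
def costBound (G : GoodGrid μ) (s K : ℝ) : ℝ := K / (1 - G.decay s)

variable {K : ℝ}

theorem costBound_nonneg (hs : 0 < s) (hK : 0 ≤ K) : 0 ≤ costBound G s K :=
  div_nonneg hK (sub_nonneg.2 (decay_lt_one hs).le)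

-- The fixed point that keeps the cost bounded in the descent: one dipole, plus the cost inherited
-- from the children.
theorem costBound_eq (hs : 0 < s) : K + G.decay s * costBound G s K = costBound G s K := by
  have : 1 - G.decay s ≠ 0 := (sub_pos.2 (decay_lt_one hs)).ne'
  rw [costBound]
  field_simp
  ring

/-- The bound for the cost of approximating a unit vector. -/
def unitCost (G : GoodGrid μ) (s K : ℝ) : ℝ := 1 + 2 * costBound G s K

/-- A constant that is admissible for both weights of the theorem. -/
def dipoleBound (G : GoodGrid μ) (s : ℝ) : ℝ := 1 + 2 * G.diracBound s

theorem one_le_dipoleBound (hs : 0 < s) : 1 ≤ dipoleBound G s := by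
  have := diracBound_nonneg (G := G) hs
  rw [dipoleBound]
  linarith

variable [IsProbabilityMeasure μ]

/-- The self-similarity that drives the descent from a cell to its children. -/
theorem average_avgCoeff_order {k : ℕ} (Q : G.Cell k) :
    average (H.order k Q) (fun P => H.avgCoeff s P) = H.avgCoeff s Q :=
  synth_injective (s := s) <| by
    rw [map_average, synth_avgCoeff, ← blockFun_order (H := H), blockFun_eq_average, map_average]
    simp only [synth_avgCoeff]

theorem unitCoeff_some (i : H.Idx) : H.unitCoeff (some i) = ((μ.real i.2.1.1 ^ (-s) : ℝ) : ℂ) •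
    (average i.2.2.1.1 (fun P => H.avgCoeff s P) -
      average i.2.2.1.2 fun P => H.avgCoeff s P) :=
  synth_injective (s := s) <| by
    rw [synth_unitCoeff, map_smul, map_sub, map_average, map_average]
    simp only [synth_avgCoeff, ← map_average, ← blockFun_eq_average, ← map_sub]
    rfl

theorem child_rpow_le (hs : 0 < s) {k : ℕ} {Q : G.Cell k} {P : G.Cell (k + 1)} (h : P.1 ⊆ Q.1) :
    μ.real P.1 ^ s ≤ G.decay s * μ.real Q.1 ^ s := by
  rw [GoodGrid.decay, ← Real.mul_rpow G.ratioUp_pos.le measureReal_nonneg]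
  exact Real.rpow_le_rpow measureReal_nonneg (child_measure_le h) hs.le

/-- A weight on pairs of points which is comparable both with the distance in the space of
coefficients and with the power `d̂^s` of the metric, with constant `K`. -/
structure IsDipoleWeight (H : HaarSystem G) (s K : ℝ) (w : Point G → Point G → ℝ≥0∞) :
    Prop where
  one_le : 1 ≤ K
  norm_dirac_le : ∀ z, ‖H.diracCoeff s z‖ₑ ≤ ENNReal.ofReal K
  norm_dipole_le : ∀ x y, ‖H.diracCoeff s y - H.diracCoeff s x‖ₑ ≤ ENNReal.ofReal K * w x y
  le_dHat : ∀ x y, w x y ≤ ENNReal.ofReal (K * dHat x y ^ s)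

variable {w : Point G → Point G → ℝ≥0∞}

theorem IsDipoleWeight.add_le (hw : IsDipoleWeight H s K w) (a a' : H.Coeff) :
    atomicNorm (H.diracCoeff s) w (a + a') ≤
      atomicNorm (H.diracCoeff s) w a + atomicNorm (H.diracCoeff s) w a' :=
  atomicNorm_add_le ENNReal.ofReal_ne_top hw.norm_dirac_le hw.norm_dipole_le a a'

theorem IsDipoleWeight.sub_le (hw : IsDipoleWeight H s K w) (a a' : H.Coeff) :
    atomicNorm (H.diracCoeff s) w (a - a') ≤
      atomicNorm (H.diracCoeff s) w a + atomicNorm (H.diracCoeff s) w a' := by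
  rw [sub_eq_add_neg, ← neg_one_smul ℂ a']
  refine (hw.add_le _ _).trans_eq ?_
  rw [atomicNorm_smul, enorm_neg, enorm_one, one_mul]

/-- One generation of the descent. Averaging over `S`, each child contributes its own approximant
and a dipole moving its Dirac mass to the point of `Q`. By `costBound_eq` the form of the cost bound
is preserved, while the error gains a factor `decay`. A general block `S` is allowed because
wavelets need the two halves separately. -/
theorem IsDipoleWeight.approx_average (hw : IsDipoleWeight H s K w) (hs : 0 < s) {n : ℕ}
    {k : ℕ} {Q : G.Cell k} {S : List (G.Cell (k + 1))} (hS : S ≠ []) (hSQ : ∀ P ∈ S, P.1 ⊆ Q.1)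
    {u : G.Cell (k + 1) → H.Coeff}
    (hu : ∀ P, atomicNorm (H.diracCoeff s) w (u P) ≤
      ENNReal.ofReal (costBound G s K * μ.real P.1 ^ s))
    (hu' : ∀ P, ‖H.avgCoeff s P - H.diracCoeff s (cellPoint P) - u P‖ₑ ≤
      ENNReal.ofReal (G.diracBound s * G.decay s ^ n * μ.real P.1 ^ s)) :
    ∃ v, atomicNorm (H.diracCoeff s) w v ≤ ENNReal.ofReal (costBound G s K * μ.real Q.1 ^ s) ∧
      ‖average S (fun P => H.avgCoeff s P) - H.diracCoeff s (cellPoint Q) - v‖ₑ ≤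
        ENNReal.ofReal (G.diracBound s * G.decay s ^ (n + 1) * μ.real Q.1 ^ s) := by
  have hK : 0 ≤ K := zero_le_one.trans hw.one_le
  have hB := costBound_nonneg (G := G) hs hK
  have hQ : 0 ≤ μ.real Q.1 ^ s := Real.rpow_nonneg measureReal_nonneg s
  refine ⟨average S fun P => H.diracCoeff s (cellPoint P) - H.diracCoeff s (cellPoint Q) + u P,
    apply_average_le atomicNorm_zero hw.add_le atomicNorm_smul_le hS fun P hP => ?_, ?_⟩
  · have h1 : dHat (cellPoint Q) (cellPoint P) ≤ μ.real Q.1 := by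
      have := dHat_le (x := cellPoint Q) (y := cellPoint P) (k := k)
        ((cellPoint_cell Q).trans (cellPoint_cell_parent (hSQ P hP)).symm)
      rwa [cellPoint_cell] at this
    calc _ ≤ ENNReal.ofReal (K * μ.real Q.1 ^ s) +
          ENNReal.ofReal (costBound G s K * (G.decay s * μ.real Q.1 ^ s)) := by
          refine (hw.add_le _ _).trans (add_le_add ((atomicNorm_dipole_le _ _).trans
            ((hw.le_dHat _ _).trans (ENNReal.ofReal_le_ofReal ?_)))
            ((hu P).trans (ENNReal.ofReal_le_ofReal ?_)))
          · exact mul_le_mul_of_nonneg_left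
              (Real.rpow_le_rpow (dHat_nonneg _ _) h1 hs.le) hK
          · exact mul_le_mul_of_nonneg_left (child_rpow_le hs (hSQ P hP)) hB
      _ = _ := by
          have := decay_pos (G := G) (s := s)
          rw [← ENNReal.ofReal_add (by positivity) (by positivity)]
          congr 1
          conv_rhs => rw [← costBound_eq hs]
          ring
  · have h2 : average S (fun P => H.avgCoeff s P) - H.diracCoeff s (cellPoint Q) -
        average S (fun P => H.diracCoeff s (cellPoint P) - H.diracCoeff s (cellPoint Q) + u P) =
        average S fun P => H.avgCoeff s P - H.diracCoeff s (cellPoint P) - u P := by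
      have h3 : average S (fun P => H.avgCoeff s P) - H.diracCoeff s (cellPoint Q) =
          average S fun P => H.avgCoeff s P - H.diracCoeff s (cellPoint Q) := by
        rw [average_sub, average_const hS]
      rw [h3, ← average_sub]
      congr 1
      funext P
      abel
    rw [h2]
    refine apply_average_le enorm_zero enorm_add_le (fun t a => (enorm_smul t a).le) hS
      fun P hP => (hu' P).trans (ENNReal.ofReal_le_ofReal ?_)
    calc G.diracBound s * G.decay s ^ n * μ.real P.1 ^ s
        ≤ G.diracBound s * G.decay s ^ n * (G.decay s * μ.real Q.1 ^ s) :=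
          mul_le_mul_of_nonneg_left (child_rpow_le hs (hSQ P hP))
            (mul_nonneg (diracBound_nonneg hs) (pow_nonneg decay_pos.le _))
      _ = _ := by ring

theorem IsDipoleWeight.approx_cell (hw : IsDipoleWeight H s K w) (hs : 0 < s) (n : ℕ) {k : ℕ}
    (Q : G.Cell k) : ∃ u,
      atomicNorm (H.diracCoeff s) w u ≤ ENNReal.ofReal (costBound G s K * μ.real Q.1 ^ s) ∧
      ‖H.avgCoeff s Q - H.diracCoeff s (cellPoint Q) - u‖ₑ ≤
        ENNReal.ofReal (G.diracBound s * G.decay s ^ n * μ.real Q.1 ^ s) := by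
  induction n generalizing k with
  | zero =>
    refine ⟨0, by rw [atomicNorm_zero]; exact zero_le, ?_⟩
    rw [sub_zero, pow_zero, mul_one, ← ofReal_norm]
    have := norm_avgCoeff_sub_diracCoeff_le (H := H) hs (cellPoint Q) k
    rw [cellPoint_cell] at this
    exact ENNReal.ofReal_le_ofReal this
  | succ n ih =>
    choose u hu hu' using fun P : G.Cell (k + 1) => ih P
    have := hw.approx_average hs (order_ne_nil (H := H) Q)
      (fun P hP => (H.mem_order k Q P).1 hP) hu hu'
    rwa [average_avgCoeff_order] at this

/-- The normalisation `|Q|^{-s}` cancels the `|Q|^s` in cost and error, which makes both bounds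
independent of the wavelet. -/
theorem IsDipoleWeight.approx_unitCoeff_some (hw : IsDipoleWeight H s K w) (hs : 0 < s) (n : ℕ)
    (i : H.Idx) : ∃ u,
      atomicNorm (H.diracCoeff s) w u ≤ ENNReal.ofReal (2 * costBound G s K) ∧
      ‖H.unitCoeff (some i) - u‖ₑ ≤
        ENNReal.ofReal (2 * (G.diracBound s * G.decay s ^ (n + 1))) := by
  obtain ⟨k, Q, S, hS⟩ := i
  choose u hu hu' using fun P : G.Cell (k + 1) => hw.approx_cell hs n P
  obtain ⟨v₁, h₁, h₁'⟩ := hw.approx_average hs (haarPairs_ne_nil hS).1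
    (fun P hP => mem_pair_subset hS (List.mem_append_left _ hP)) hu hu'
  obtain ⟨v₂, h₂, h₂'⟩ := hw.approx_average hs (haarPairs_ne_nil hS).2
    (fun P hP => mem_pair_subset hS (List.mem_append_right _ hP)) hu hu'
  have hQ := Real.rpow_pos_of_pos (cell_measure_pos Q) (-s)
  have hn : ‖((μ.real Q.1 ^ (-s) : ℝ) : ℂ)‖ₑ = ENNReal.ofReal (μ.real Q.1 ^ (-s)) := by
    rw [← ofReal_norm, Complex.norm_real, Real.norm_of_nonneg hQ.le]
  have hQQ : μ.real Q.1 ^ (-s) * μ.real Q.1 ^ s = 1 := by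
    rw [← Real.rpow_add (cell_measure_pos Q), neg_add_cancel, Real.rpow_zero]
  have key : ∀ (C : ℝ) (p q : ℝ≥0∞), 0 ≤ C → p ≤ ENNReal.ofReal (C * μ.real Q.1 ^ s) →
      q ≤ ENNReal.ofReal (C * μ.real Q.1 ^ s) →
      ‖((μ.real Q.1 ^ (-s) : ℝ) : ℂ)‖ₑ * (p + q) ≤ ENNReal.ofReal (2 * C) := by
    intro C p q hC hp hq
    have h0 : 0 ≤ C * μ.real Q.1 ^ s :=
      mul_nonneg hC (Real.rpow_nonneg measureReal_nonneg _)
    refine (mul_le_mul_right (add_le_add hp hq) _).trans_eq ?_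
    rw [hn, ← ENNReal.ofReal_add h0 h0, ← ENNReal.ofReal_mul hQ.le]
    congr 1
    linear_combination 2 * C * hQQ
  refine ⟨((μ.real Q.1 ^ (-s) : ℝ) : ℂ) • (v₁ - v₂), ?_, ?_⟩
  · refine (atomicNorm_smul_le _ _).trans ((mul_le_mul_right (hw.sub_le _ _) _).trans ?_)
    exact key _ _ _ (costBound_nonneg hs (zero_le_one.trans hw.one_le)) h₁ h₂
  · rw [unitCoeff_some (s := s), ← smul_sub, enorm_smul]
    refine (mul_le_mul_right ?_ _).trans (key _ _ _ (mul_nonneg (diracBound_nonneg hs)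
      (pow_nonneg decay_pos.le _)) h₁' h₂')
    -- The Dirac mass at the point of `Q` is the same for both blocks and drops out of the
    -- difference: no monopole has to be paid for.
    refine le_trans (le_of_eq (congrArg _ ?_)) enorm_sub_le
    abel

theorem IsDipoleWeight.approx_unitCoeff (hw : IsDipoleWeight H s K w) (hs : 0 < s)
    (o : Option H.Idx) : ∃ u,
      atomicNorm (H.diracCoeff s) w u ≤ ENNReal.ofReal (unitCost G s K) ∧
      ‖H.unitCoeff o - u‖ₑ ≤ 4⁻¹ := by
  have hB := costBound_nonneg (G := G) hs (zero_le_one.trans hw.one_le)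
  have h4 : (4⁻¹ : ℝ≥0∞) = ENNReal.ofReal 4⁻¹ := by
    rw [ENNReal.ofReal_inv_of_pos (by norm_num)]
    norm_num
  -- The number of generations depends neither on `o` nor on its cell.
  obtain ⟨n, hn⟩ : ∃ n : ℕ, 2 * (G.diracBound s * G.decay s ^ (n + 1)) ≤ 4⁻¹ := by
    have h : Tendsto (fun n : ℕ => 2 * (G.diracBound s * G.decay s ^ (n + 1))) atTop (𝓝 0) := by
      have := ((tendsto_pow_atTop_nhds_zero_of_lt_one (decay_pos (G := G) (s := s)).le
        (decay_lt_one hs)).comp (tendsto_add_atTop_nat 1)).const_mul (G.diracBound s)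
        |>.const_mul 2
      simpa using this
    exact (h.eventually_le_const (by norm_num)).exists
  rw [h4]
  cases o with
  | some i =>
    obtain ⟨u, hu, hu'⟩ := hw.approx_unitCoeff_some hs n i
    refine ⟨u, hu.trans (ENNReal.ofReal_le_ofReal ?_),
      hu'.trans (ENNReal.ofReal_le_ofReal hn)⟩
    rw [unitCost]
    linarith
  | none =>
    obtain ⟨u, hu, hu'⟩ := hw.approx_cell hs (n + 1) G.root
    have h1 : μ.real (G.root (μ := μ)).1 = 1 := probReal_univ
    rw [h1, Real.one_rpow, mul_one] at hu hu'
    refine ⟨H.diracCoeff s (cellPoint G.root) + u, ?_, ?_⟩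
    · refine (hw.add_le _ _).trans ((add_le_add (atomicNorm_atom_le _) hu).trans ?_)
      rw [← ENNReal.ofReal_one, ← ENNReal.ofReal_add zero_le_one hB, unitCost]
      exact ENNReal.ofReal_le_ofReal (by linarith)
    · rw [← sub_sub, ← avgCoeff_root (s := s)]
      refine hu'.trans (ENNReal.ofReal_le_ofReal (le_trans ?_ hn))
      have := mul_nonneg (diracBound_nonneg (G := G) hs)
        (pow_nonneg (decay_pos (G := G) (s := s)).le (n + 1))
      linarith

theorem IsDipoleWeight.approx (hw : IsDipoleWeight H s K w) (hs : 0 < s) (a : H.Coeff) : ∃ u,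
    atomicNorm (H.diracCoeff s) w u ≤ ENNReal.ofReal (unitCost G s K) * ‖a‖ₑ ∧
    ‖a - u‖ₑ ≤ 2⁻¹ * ‖a‖ₑ := by
  classical
  rcases eq_or_ne a 0 with rfl | ha
  · exact ⟨0, by rw [atomicNorm_zero]; exact zero_le, by simp⟩
  choose g hg hg' using hw.approx_unitCoeff hs
  have ha0 : ‖a‖ₑ ≠ 0 := by simpa using ha
  have hsingle : ∀ o, lp.single 1 o (a o) = a o • H.unitCoeff o := fun o => by
    rw [HaarSystem.unitCoeff, ← lp.single_smul, smul_eq_mul, mul_one]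
  have hsum : HasSum (fun o => a o • H.unitCoeff o) a := by
    simpa only [hsingle] using lp.hasSum_single (p := 1) ENNReal.one_ne_top a
  -- Half of the allowed error `2⁻¹` is spent on truncation, the other half on approximating the
  -- unit vectors. Finite truncation means that only finite subadditivity is needed here.
  obtain ⟨F, hF⟩ : ∃ F : Finset (Option H.Idx),
      ‖a - ∑ o ∈ F, a o • H.unitCoeff o‖ₑ ≤ 4⁻¹ * ‖a‖ₑ := by
    have h : Tendsto (fun F : Finset (Option H.Idx) => ‖a - ∑ o ∈ F, a o • H.unitCoeff o‖ₑ)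
        atTop (𝓝 0) := by
      have := (hsum.const_sub a).enorm
      simpa using this
    exact (h.eventually_le_const (by
      refine ENNReal.mul_pos ?_ ha0
      simp)).exists
  have hFa : ∑ o ∈ F, ‖a o‖ₑ ≤ ‖a‖ₑ := by
    rw [enorm_coeff]
    exact ENNReal.sum_le_tsum F
  refine ⟨∑ o ∈ F, a o • g o, ?_, ?_⟩
  · refine (atomicNorm_sum_le ENNReal.ofReal_ne_top hw.norm_dirac_le hw.norm_dipole_le F _).trans ?_
    calc ∑ o ∈ F, atomicNorm (H.diracCoeff s) w (a o • g o)
        ≤ ∑ o ∈ F, ENNReal.ofReal (unitCost G s K) * ‖a o‖ₑ := by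
          refine Finset.sum_le_sum fun o _ => (atomicNorm_smul_le _ _).trans ?_
          rw [mul_comm]
          gcongr
          exact hg o
      _ ≤ _ := by
          rw [← Finset.mul_sum]
          gcongr
  · have h1 : a - ∑ o ∈ F, a o • g o = (a - ∑ o ∈ F, a o • H.unitCoeff o) +
        ∑ o ∈ F, a o • (H.unitCoeff o - g o) := by
      simp only [smul_sub, Finset.sum_sub_distrib]
      abel
    have h2 : (2⁻¹ : ℝ≥0∞) = 4⁻¹ + 4⁻¹ := by
      have h3 : (4 : ℝ≥0∞)⁻¹ = 2⁻¹ / 2 := by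
        rw [div_eq_mul_inv, ← ENNReal.mul_inv (by simp) (by simp)]
        norm_num
      rw [h3, ENNReal.add_halves]
    rw [h1, h2, add_mul]
    refine (enorm_add_le _ _).trans (add_le_add hF ((enorm_sum_le _ _).trans ?_))
    calc ∑ o ∈ F, ‖a o • (H.unitCoeff o - g o)‖ₑ ≤ ∑ o ∈ F, 4⁻¹ * ‖a o‖ₑ := by
          refine Finset.sum_le_sum fun o _ => ?_
          rw [enorm_smul, mul_comm]
          gcongr
          exact hg' o
      _ ≤ _ := by
          rw [← Finset.mul_sum]
          gcongr

theorem IsDipoleWeight.isNormOn_and_equivOn (hw : IsDipoleWeight H s K w) (hs : 0 < s) :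
    IsNormOn (H.negBesov s) (H.ddNormWith s w) ∧
      EquivOn (H.negBesov s) (H.ddNormWith s w) (H.negNorm s) := by
  have hK := zero_lt_one.trans_le hw.one_le
  have hB := costBound_nonneg (G := G) hs hK.le
  have hM : 0 ≤ unitCost G s K := by rw [unitCost]; linarith
  have hup : ∀ a : H.Coeff, atomicNorm (H.diracCoeff s) w a ≤
      ENNReal.ofReal (unitCost G s K * 2) * ‖a‖ₑ := fun a => by
    rw [ENNReal.ofReal_mul hM, ENNReal.ofReal_ofNat]
    exact atomicNorm_le_of_approx ENNReal.ofReal_ne_top hw.norm_dirac_le hw.norm_dipole_le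
      (hw.approx hs) a
  have hlow : ∀ a : H.Coeff, ‖a‖ₑ ≤ ENNReal.ofReal K * atomicNorm (H.diracCoeff s) w a :=
    enorm_le_atomicNorm (ENNReal.ofReal_pos.2 hK).ne' ENNReal.ofReal_ne_top hw.norm_dirac_le
      hw.norm_dipole_le
  refine ⟨⟨fun φ hφ => ?_, fun φ hφ => ?_, fun t φ hφ => ?_, fun φ hφ φ' hφ' => ?_⟩,
    max K (unitCost G s K * 2), lt_max_of_lt_left hK, fun φ hφ => ?_⟩
  · obtain ⟨a, rfl⟩ := mem_negBesov_iff.1 hφ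
    rw [ddNormWith_synth hs]
    exact (hup a).trans_lt (ENNReal.mul_lt_top ENNReal.ofReal_lt_top enorm_lt_top)
  · obtain ⟨a, rfl⟩ := mem_negBesov_iff.1 hφ
    rw [ddNormWith_synth hs]
    refine ⟨fun h => ?_, fun h => ?_⟩
    · have := hlow a
      rw [h, mul_zero, nonpos_iff_eq_zero, enorm_eq_zero] at this
      rw [this, map_zero]
    · rw [synth_injective (h.trans (map_zero _).symm), atomicNorm_zero]
  · obtain ⟨a, rfl⟩ := mem_negBesov_iff.1 hφ
    rw [← map_smul, ddNormWith_synth hs, ddNormWith_synth hs, atomicNorm_smul]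
  · obtain ⟨a, rfl⟩ := mem_negBesov_iff.1 hφ
    obtain ⟨a', rfl⟩ := mem_negBesov_iff.1 hφ'
    rw [← map_add, ddNormWith_synth hs, ddNormWith_synth hs, ddNormWith_synth hs]
    exact hw.add_le a a'
  · obtain ⟨a, rfl⟩ := mem_negBesov_iff.1 hφ
    rw [ddNormWith_synth hs, negNorm_synth]
    constructor
    · refine (hup a).trans ?_
      gcongr
      exact le_max_right _ _
    · refine (hlow a).trans ?_
      gcongr
      exact le_max_left _ _

/-! ### The two weights of the theorem -/

theorem enorm_diracCoeff_le (hs : 0 < s) (z : Point G) :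
    ‖H.diracCoeff s z‖ₑ ≤ ENNReal.ofReal (dipoleBound G s) := by
  rw [← ofReal_norm]
  refine ENNReal.ofReal_le_ofReal ((norm_diracCoeff_le hs z).trans ?_)
  have := diracBound_nonneg (G := G) hs
  rw [dipoleBound]
  linarith

theorem enorm_diracCoeff_sub_le (hs : 0 < s) (x y : Point G) :
    ‖H.diracCoeff s y - H.diracCoeff s x‖ₑ ≤ ENNReal.ofReal (dipoleBound G s * dHat x y ^ s) := by
  rw [← ofReal_norm]
  refine ENNReal.ofReal_le_ofReal ((norm_diracCoeff_sub_le hs x y).trans ?_)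
  refine mul_le_mul_of_nonneg_right ?_ (Real.rpow_nonneg (dHat_nonneg x y) s)
  rw [dipoleBound]
  linarith

theorem isDipoleWeight_dHat (hs : 0 < s) :
    IsDipoleWeight H s (dipoleBound G s) fun x y => ENNReal.ofReal (dHat x y ^ s) where
  one_le := one_le_dipoleBound hs
  norm_dirac_le := enorm_diracCoeff_le hs
  norm_dipole_le x y := by
    rw [← ENNReal.ofReal_mul (zero_le_one.trans (one_le_dipoleBound hs))]
    exact enorm_diracCoeff_sub_le hs x y
  le_dHat x y := ENNReal.ofReal_le_ofReal
    (le_mul_of_one_le_left (Real.rpow_nonneg (dHat_nonneg x y) s) (one_le_dipoleBound hs))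

theorem isDipoleWeight_negNorm (hs : 0 < s) : IsDipoleWeight H s (dipoleBound G s)
    fun x y => H.negNorm s (H.dirac s y - H.dirac s x) where
  one_le := one_le_dipoleBound hs
  norm_dirac_le := enorm_diracCoeff_le hs
  norm_dipole_le x y := by
    rw [dirac_eq hs, dirac_eq hs, ← map_sub, negNorm_synth]
    exact le_mul_of_one_le_left zero_le (ENNReal.one_le_ofReal.2 (one_le_dipoleBound hs))
  le_dHat x y := by
    rw [dirac_eq hs, dirac_eq hs, ← map_sub, negNorm_synth]
    exact enorm_diracCoeff_sub_le hs x y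

end

end DiracDipole

end

open DiracDipole in
theorem theorem6 {Ω : Type*} [MeasurableSpace Ω] (μ : Measure Ω) [IsProbabilityMeasure μ]
    (G : GoodGrid μ) (H : HaarSystem G) (s : ℝ) (hs : 0 < s) :
    (IsNormOn (H.negBesov s) (H.ddNorm s) ∧
      EquivOn (H.negBesov s) (H.ddNorm s) (H.negNorm s)) ∧
    (IsNormOn (H.negBesov s) (H.ddNorm' s) ∧
      EquivOn (H.negBesov s) (H.ddNorm' s) (H.negNorm s)) :=
  ⟨(isDipoleWeight_dHat hs).isNormOn_and_equivOn hs,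
    (isDipoleWeight_negNorm hs).isNormOn_and_equivOn hs⟩
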